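/- Let $n\ge 2$ and $\lambda\in(0,1)$, let $e_1$ be the first canonical basis vector of $\mathbb{R}^n$, and let $K=\{-\lambda e_1\otimes e_1,\,(1-\lambda)e_1\otimes e_1\}\subset\mathbb{R}^{n\times n}$, $K_0=K\cup\{\mathbf 0\}$. For $\epsilon>0$ and $\chi\in BV(\mathbb{R}^n;K_0)$ set $$E_\epsilon(\chi)=\inf_{u\in H^1(\mathbb{R}^n;\mathbb{R}^n)}\int_{\mathbb{R}^n}|\nabla u-\chi|^2\,dx+\epsilon\,|D\chi|(\mathbb{R}^n),$$ where $|\cdot|$ is the Euclidean (Frobenius) norm and $|D\chi|(\mathbb{R}^n)$ is the total variation of $\chi$. For $V>0$ set $$E_\epsilon(V)=\inf\big\{E_\epsilon(\chi)\,:\,\chi\in BV(\mathbb{R}^n;K_0),\ |\{x:\chi(x)\neq\mathbf 0\}|=V\big\}.$$ Then there exist two constants $C_2>C_1>0$, depending only on $K$ and $n$, such that for every $V>0$ and every $\epsilon>0$ $$C_1\, r_\epsilon(V)\le E_\epsilon(V)\le C_2\, r_\epsilon(V),\qquad r_\epsilon(V)=\begin{cases}\epsilon\, V^{\frac{n-1}{n}}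 & \text{if } V\le\epsilon^n,\\ \epsilon^{\frac{2n}{3n-1}}\,V^{\frac{3n-3}{3n-1}} & \text{if } V>\epsilon^n.\end{cases}$$ -/

import Mathlib

open MeasureTheory
open scoped ENNReal ContDiff

noncomputable section

namespace Nucleation

/-- `ℝⁿ` with the Euclidean norm and Lebesgue measure. -/
abbrev Space (n : ℕ) : Type := EuclideanSpace ℝ (Fin n)

/-- Real `n × n` matrices. -/
abbrev Mat (n : ℕ) : Type := Matrix (Fin n) (Fin n) ℝ

/-- The partial derivative `∂_k f` of a map on `ℝⁿ`. -/
def partialDeriv {n : ℕ} {F : Type*} [NormedAddCommGroup F] [NormedSpace ℝ F]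
    (k : Fin n) (f : Space n → F) (x : Space n) : F :=
  fderiv ℝ f x (EuclideanSpace.single k 1)

/-- `u ∈ H¹(ℝⁿ; ℝⁿ)` with weak gradient `G`, i.e. `u` and `G` are square integrable and
`G i j = ∂_j u_i` in the sense of integration against smooth compactly supported functions. -/
structure IsH1WithGradient {n : ℕ} (u : Space n → Space n) (G : Space n → Mat n) : Prop where
  memLp : MemLp u 2 volume
  memLp_gradient : ∀ i j : Fin n, MemLp (fun x => G x i j) 2 volume
  integral_by_parts : ∀ φ : Space n → ℝ, ContDiff ℝ ∞ φ → HasCompactSupport φ →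
    ∀ i j : Fin n, ∫ x, u x i * partialDeriv j φ x = - ∫ x, G x i j * φ x

/-- `∫ |G - χ|² dx`, with the Euclidean (Frobenius) norm of matrices. -/
def elasticEnergyOf {n : ℕ} (G χ : Space n → Mat n) : ℝ≥0∞ :=
  ∫⁻ x, ENNReal.ofReal (∑ i, ∑ j, (G x i j - χ x i j) ^ 2)

/-- `E_el(χ)`, the infimum of `∫ |∇u - χ|² dx` over `u ∈ H¹(ℝⁿ; ℝⁿ)`. -/
def elasticEnergy {n : ℕ} (χ : Space n → Mat n) : ℝ≥0∞ :=
  ⨅ (u : Space n → Space n) (G : Space n → Mat n) (_ : IsH1WithGradient u G),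
    elasticEnergyOf G χ

/-- The total variation `|Dχ|(ℝⁿ)` of a locally integrable matrix field: the supremum of
`∑ i j, ∫ χ_ij div φ_ij dx` over `C¹` compactly supported `φ = (φ_ijk)` with `|φ| ≤ 1` pointwise
in the Euclidean norm. -/
def totalVariation {n : ℕ} (χ : Space n → Mat n) : ℝ≥0∞ :=
  ⨆ (φ : Space n → Fin n → Fin n → Fin n → ℝ) (_ : ContDiff ℝ 1 φ) (_ : HasCompactSupport φ)
    (_ : ∀ x, ∑ i, ∑ j, ∑ k, φ x i j k ^ 2 ≤ 1),
    ENNReal.ofReal (∑ i, ∑ j, ∫ x, χ x i j * ∑ k, partialDeriv k φ x i j k)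

/-- `χ ∈ BV(ℝⁿ; S)`: an integrable matrix field of finite total variation with values in `S`. -/
structure IsBVInto {n : ℕ} (S : Set (Mat n)) (χ : Space n → Mat n) : Prop where
  integrable : ∀ i j : Fin n, Integrable (fun x => χ x i j) volume
  totalVariation_lt_top : totalVariation χ < ⊤
  mem : ∀ᵐ x, χ x ∈ S

/-- `E_ε(χ) = E_el(χ) + ε |Dχ|(ℝⁿ)`. -/
def energy {n : ℕ} (ε : ℝ) (χ : Space n → Mat n) : ℝ≥0∞ :=
  elasticEnergy χ + ENNReal.ofReal ε * totalVariation χ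

/-- `E_ε(V)`, the infimum of `E_ε(χ)` over `χ ∈ BV(ℝⁿ; K ∪ {0})` with `|{χ ≠ 0}| = V`. -/
def minimalEnergy {n : ℕ} (K : Set (Mat n)) (ε V : ℝ) : ℝ≥0∞ :=
  ⨅ (χ : Space n → Mat n) (_ : IsBVInto (K ∪ {0}) χ)
    (_ : volume (Function.support χ) = ENNReal.ofReal V), energy ε χ

/-- The first canonical basis vector `e₁` (coordinates are numbered from `0` in `Fin n`). -/
def firstBasisVector (n : ℕ) : Fin n → ℝ := fun i => if (i : ℕ) = 0 then 1 else 0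

/-- The set of wells `{-λ e₁ ⊗ e₁, (1 - λ) e₁ ⊗ e₁}`. -/
def wells (n : ℕ) (lam : ℝ) : Set (Mat n) :=
  {(-lam) • Matrix.vecMulVec (firstBasisVector n) (firstBasisVector n),
    (1 - lam) • Matrix.vecMulVec (firstBasisVector n) (firstBasisVector n)}

/-- The scaling function `r_ε(V)`. -/
def scalingRate (n : ℕ) (ε V : ℝ) : ℝ :=
  if V ≤ ε ^ n then ε * V ^ (((n : ℝ) - 1) / (n : ℝ))
  else ε ^ ((2 * (n : ℝ)) / (3 * (n : ℝ) - 1)) *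
    V ^ ((3 * (n : ℝ) - 3) / (3 * (n : ℝ) - 1))

end Nucleation

end

/-! Both bounds rest on one picture: an inclusion of width L along e₁ and height H across, with L
H^(n-1) = V. Up to constants, its surface costs ε H^(n-1) and its elastic energy is (L/H)² V.
`exists_scales` takes L = H when V ≤ ε^n and otherwise balances the two costs; in both cases r_ε(V)
= ε H^(n-1).

Lower bound (`le_minimalEnergy`). Let f = χ₁₁ and κ = min(λ, 1-λ)². Since ∫ f² ≥ κV and ∫ |f| ≤ V,
some smooth g with |g| ≤ 1 and ∫ |g| ≤ V satisfies ∫ f g > κV/2 (`exists_isTest_approx`). Averaging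
g over a box of volume at least KV, with K = 8/κ, pushes its supremum below 1/K, so its pairing with
f drops to at most κV/8. If the energy were much smaller than r_ε(V), averaging would hardly change
the pairing, a contradiction. Averaging over a length a costs at most a |Dχ|
(`abs_integral_sub_avg_le_totalVariation`), which suffices when L = H. For an elongated box this is
too expensive in the directions across e₁. There one uses that G is a gradient: ∂ₖ G₁₁ = ∂₁ G₁ₖ, and
G₁ₖ is small in L² because χ₁ₖ = 0 (`abs_integral_sub_avg_le_elastic`). A previous average along e₁
pays for the derivative ∂₁.

Upper bound (`exists_minimalEnergy_le`). On a bipyramid the tent function has axial slopes exactly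
1-λ and -λ, and transverse slopes at most L/H. Only the transverse slopes cost elastic energy, and
convexity bounds the surface term. -/

noncomputable section

namespace Nucleation

/-! ### Averages along a segment -/

/-- The average `∫ h (x - r w) dν(r)` of the translates of `h` along a direction `w`. -/
def avg {n : ℕ} {F : Type*} [NormedAddCommGroup F] [NormedSpace ℝ F] (ν : Measure ℝ)
    (w : Space n) (h : Space n → F) (x : Space n) : F :=
  ∫ r, h (x - r • w) ∂ν

lemma integrable_comp_segment {n : ℕ} {F : Type*} [NormedAddCommGroup F] {ν : Measure ℝ}
    {w : Space n} [IsFiniteMeasure ν] {h : Space n → F} (hc : Continuous h)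
    (hs : HasCompactSupport h) (x : Space n) : Integrable (fun r => h (x - r • w)) ν := by
  obtain ⟨C, hC⟩ := hs.exists_bound_of_continuous hc
  exact Integrable.of_bound (Continuous.aestronglyMeasurable (by fun_prop)) C (.of_forall fun r => hC _)

section Avg

variable {n : ℕ} {F : Type} [NormedAddCommGroup F] [NormedSpace ℝ F] {ν : Measure ℝ}
  {w : Space n}

lemma hasFDerivAt_avg [IsFiniteMeasure ν] {h : Space n → F} (hh : ContDiff ℝ 1 h)
    (hs : HasCompactSupport h) (x : Space n) :
    HasFDerivAt (avg ν w h) (avg ν w (fderiv ℝ h) x) x := by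
  have hc' : Continuous (fderiv ℝ h) := hh.continuous_fderiv one_ne_zero
  obtain ⟨C, hC⟩ := (hs.fderiv ℝ).exists_bound_of_continuous hc'
  have hc := hh.continuous
  refine hasFDerivAt_integral_of_dominated_of_fderiv_le (F' := fun y r => fderiv ℝ h (y - r • w))
    (bound := fun _ => C) Filter.univ_mem ?_ ?_ ?_ ?_ ?_ ?_
  · exact .of_forall fun y => Continuous.aestronglyMeasurable (by fun_prop)
  · exact integrable_comp_segment hc hs x
  · exact Continuous.aestronglyMeasurable (by fun_prop)
  · exact .of_forall fun r y _ => hC _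
  · exact integrable_const _
  · refine .of_forall fun r y _ => ?_
    have := ((hh.differentiable one_ne_zero).differentiableAt (x := y - r • w)).hasFDerivAt.comp y
      ((hasFDerivAt_id y).sub_const (r • w))
    simpa [Function.comp_def] using this

/-- Averaging commutes with differentiation. The target space is quantified inside the induction
because the derivative takes values in another space. -/
lemma contDiff_nat_avg [IsFiniteMeasure ν] (m : ℕ) : ∀ {F : Type} [NormedAddCommGroup F]
    [NormedSpace ℝ F] {h : Space n → F}, ContDiff ℝ ∞ h → HasCompactSupport h →
    ContDiff ℝ m (avg ν w h) := by
  induction m with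
  | zero =>
    intro F _ _ h hh hs
    have hd : Differentiable ℝ (avg ν w h) := fun x =>
      (hasFDerivAt_avg (hh.of_le (by simp)) hs x).differentiableAt
    exact contDiff_zero.2 hd.continuous
  | succ m ih =>
    intro F _ _ h hh hs
    have hd : ∀ x, HasFDerivAt (avg ν w h) (avg ν w (fderiv ℝ h) x) x := fun x =>
      hasFDerivAt_avg (hh.of_le (by simp)) hs x
    rw [Nat.cast_succ]
    refine contDiff_succ_iff_fderiv.2 ⟨fun x => (hd x).differentiableAt, by simp, ?_⟩
    rw [show fderiv ℝ (avg ν w h) = avg ν w (fderiv ℝ h) from funext fun x => (hd x).fderiv]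
    exact ih (hh.fderiv_right le_rfl) (hs.fderiv ℝ)

lemma contDiff_avg [IsFiniteMeasure ν] {h : Space n → F} (hh : ContDiff ℝ ∞ h)
    (hs : HasCompactSupport h) : ContDiff ℝ ∞ (avg ν w h) :=
  contDiff_infty.2 fun m => contDiff_nat_avg m hh hs

lemma hasCompactSupport_avg (hν : ∀ᵐ r ∂ν, r ∈ Set.Icc (0 : ℝ) 1) {h : Space n → F}
    (hs : HasCompactSupport h) : HasCompactSupport (avg ν w h) := by
  have hK : IsCompact ((fun p : Space n × ℝ => p.1 + p.2 • w) '' (tsupport h ×ˢ Set.Icc 0 1)) :=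
    (hs.isCompact.prod isCompact_Icc).image (by fun_prop)
  refine HasCompactSupport.intro hK fun x hx => ?_
  refine integral_eq_zero_of_ae ?_
  filter_upwards [hν] with r hr
  by_contra hne
  exact hx ⟨(x - r • w, r), ⟨subset_tsupport _ hne, hr⟩, by simp⟩

lemma norm_avg_le (hν : ν Set.univ ≤ 1) {h : Space n → F} {C : ℝ}
    (hC : ∀ x, ‖h x‖ ≤ C) (x : Space n) : ‖avg ν w h x‖ ≤ C := by
  have : IsFiniteMeasure ν := ⟨hν.trans_lt ENNReal.one_lt_top⟩
  have hC0 : 0 ≤ C := (norm_nonneg _).trans (hC x)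
  refine (norm_integral_le_of_norm_le_const (.of_forall fun r => hC (x - r • w))).trans ?_
  refine mul_le_of_le_one_right hC0 ?_
  simpa [Measure.real] using ENNReal.toReal_mono ENNReal.one_ne_top hν

lemma avg_comm {ν' : Measure ℝ} {w' : Space n} [IsFiniteMeasure ν] [IsFiniteMeasure ν']
    {h : Space n → F} (hc : Continuous h) (hs : HasCompactSupport h) :
    avg ν w (avg ν' w' h) = avg ν' w' (avg ν w h) := by
  funext x
  obtain ⟨C, hC⟩ := hs.exists_bound_of_continuous hc
  unfold avg
  rw [integral_integral_swap]
  · simp_rw [sub_right_comm]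
  · exact Integrable.of_bound (Continuous.aestronglyMeasurable
      (f := fun p : ℝ × ℝ => h (x - p.1 • w - p.2 • w')) (by fun_prop)) C (.of_forall fun r => hC _)

lemma integral_avg_sq_le (hν : ν Set.univ ≤ 1) {h : Space n → ℝ} (hc : Continuous h)
    (hs : HasCompactSupport h) : ∫ x, avg ν w h x ^ 2 ≤ ∫ x, h x ^ 2 := by
  have : IsFiniteMeasure ν := ⟨hν.trans_lt ENNReal.one_lt_top⟩
  have hν' : ν.real Set.univ ≤ 1 := by
    simpa [Measure.real] using ENNReal.toReal_mono ENNReal.one_ne_top hν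
  have hc2 : Continuous fun x => h x ^ 2 := by fun_prop
  have hs2 : HasCompactSupport fun x => h x ^ 2 := by
    simpa [pow_two] using! hs.mul_right (f' := h)
  have hi2 : Integrable fun x => h x ^ 2 := hc2.integrable_of_hasCompactSupport hs2
  have jensen : ∀ x, avg ν w h x ^ 2 ≤ avg ν w (fun y => h y ^ 2) x := by
    intro x
    set m := avg ν w h x with hm
    -- Jensen's inequality by expanding the variance; a total mass below 1 only helps, since it
    -- multiplies m².
    have h1 : 0 ≤ ∫ r, (h (x - r • w) - m) ^ 2 ∂ν := integral_nonneg fun r => sq_nonneg _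
    have hi := integrable_comp_segment (ν := ν) (w := w) hc hs x
    have hi' := integrable_comp_segment (ν := ν) (w := w) hc2 hs2 x
    have h2 : ∫ r, (h (x - r • w) - m) ^ 2 ∂ν
        = avg ν w (fun y => h y ^ 2) x - 2 * m * m + ν.real Set.univ * m ^ 2 := by
      have : ∀ r : ℝ, (h (x - r • w) - m) ^ 2
          = (h (x - r • w) ^ 2 - 2 * m * h (x - r • w)) + m ^ 2 := fun r => by ring
      simp_rw [this]
      rw [integral_add (f := fun r => h (x - r • w) ^ 2 - 2 * m * h (x - r • w))
          (hi'.sub (hi.const_mul _)) (integrable_const _),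
        integral_sub hi' (hi.const_mul _), integral_const_mul, integral_const]
      simp [avg, hm]
    nlinarith [sq_nonneg m]
  have hprod : Integrable (fun p : Space n × ℝ => h (p.1 - p.2 • w) ^ 2) (volume.prod ν) := by
    rw [integrable_prod_iff' (Continuous.aestronglyMeasurable (by fun_prop))]
    refine ⟨.of_forall fun r => hi2.comp_sub_right (r • w), ?_⟩
    have : ∀ r : ℝ, ∫ x, ‖h (x - r • w) ^ 2‖ = ∫ x, ‖h x ^ 2‖ := fun r =>
      integral_sub_right_eq_self (fun x => ‖h x ^ 2‖) (r • w)
    simp_rw [this]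
    exact integrable_const _
  calc ∫ x, avg ν w h x ^ 2 ≤ ∫ x, avg ν w (fun y => h y ^ 2) x :=
        integral_mono_of_nonneg (.of_forall fun x => sq_nonneg _) hprod.integral_prod_left
          (.of_forall jensen)
    _ = ∫ r, ∫ x, h (x - r • w) ^ 2 ∂volume ∂ν := integral_integral_swap hprod
    _ = ν.real Set.univ * ∫ x, h x ^ 2 := by
        have : ∀ r : ℝ, ∫ x, h (x - r • w) ^ 2 = ∫ x, h x ^ 2 := fun r =>
          integral_sub_right_eq_self (fun x => h x ^ 2) (r • w)
        simp_rw [this, integral_const, smul_eq_mul]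
    _ ≤ _ := mul_le_of_le_one_left (integral_nonneg fun x => sq_nonneg _) hν'

end Avg

/-! ### Two averaging measures and the exact derivatives of their averages -/

/-- Lebesgue measure on the unit interval. -/
def uniformMeasure : Measure ℝ := volume.restrict (Set.Ioc 0 1)

/-- The measure with density `1 - r` on the unit interval. -/
def slopeMeasure : Measure ℝ := uniformMeasure.withDensity fun r => ENNReal.ofReal (1 - r)

lemma uniformMeasure_univ : uniformMeasure Set.univ ≤ 1 := by simp [uniformMeasure]

lemma ae_uniformMeasure : ∀ᵐ r ∂uniformMeasure, r ∈ Set.Icc (0 : ℝ) 1 := by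
  filter_upwards [ae_restrict_mem measurableSet_Ioc] with r hr using ⟨hr.1.le, hr.2⟩

instance : IsFiniteMeasure uniformMeasure := ⟨uniformMeasure_univ.trans_lt ENNReal.one_lt_top⟩

lemma slopeMeasure_univ : slopeMeasure Set.univ ≤ 1 := by
  rw [slopeMeasure, withDensity_apply _ MeasurableSet.univ, Measure.restrict_univ]
  refine (lintegral_mono_ae (g := fun _ => 1) ?_).trans (by simpa using uniformMeasure_univ)
  filter_upwards [ae_uniformMeasure] with r hr
  exact ENNReal.ofReal_le_one.2 (by linarith [hr.1])

lemma ae_slopeMeasure : ∀ᵐ r ∂slopeMeasure, r ∈ Set.Icc (0 : ℝ) 1 :=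
  (withDensity_absolutelyContinuous _ _).ae_le ae_uniformMeasure

instance : IsFiniteMeasure slopeMeasure := ⟨slopeMeasure_univ.trans_lt ENNReal.one_lt_top⟩

lemma integral_uniformMeasure (f : ℝ → ℝ) : ∫ r, f r ∂uniformMeasure = ∫ r in (0 : ℝ)..1, f r := by
  rw [intervalIntegral.integral_of_le zero_le_one, uniformMeasure]

lemma integral_slopeMeasure (f : ℝ → ℝ) :
    ∫ r, f r ∂slopeMeasure = ∫ r in (0 : ℝ)..1, (1 - r) * f r := by
  rw [slopeMeasure, integral_withDensity_eq_integral_toReal_smul (by fun_prop) (by simp),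
    ← integral_uniformMeasure]
  refine integral_congr_ae ?_
  filter_upwards [ae_uniformMeasure] with r hr
  rw [ENNReal.toReal_ofReal (by linarith [hr.2]), smul_eq_mul]

section Derivative

variable {n : ℕ} {w : Space n} {h : Space n → ℝ}

lemma hasDerivAt_comp_segment (hh : ContDiff ℝ 1 h) (x : Space n) (r : ℝ) :
    HasDerivAt (fun r : ℝ => h (x - r • w)) (-fderiv ℝ h (x - r • w) w) r := by
  have h1 : HasDerivAt (fun r : ℝ => x - r • w) (-w) r := by
    simpa using ((hasDerivAt_id r).smul_const w).const_sub x
  simpa [Function.comp_def] using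
    ((hh.differentiable one_ne_zero).differentiableAt (x := x - r • w)).hasFDerivAt.comp_hasDerivAt
      r h1

lemma fderiv_avg_apply {ν : Measure ℝ} [IsFiniteMeasure ν] (hh : ContDiff ℝ 1 h)
    (hs : HasCompactSupport h) (x v : Space n) :
    fderiv ℝ (avg ν w h) x v = ∫ r, fderiv ℝ h (x - r • w) v ∂ν := by
  rw [(hasFDerivAt_avg hh hs x).fderiv, avg, ContinuousLinearMap.integral_apply]
  exact integrable_comp_segment (hh.continuous_fderiv one_ne_zero) (hs.fderiv ℝ) x

lemma fderiv_avg_uniformMeasure (hh : ContDiff ℝ 1 h) (hs : HasCompactSupport h) (x : Space n) :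
    fderiv ℝ (avg uniformMeasure w h) x w = h x - h (x - w) := by
  have hc' := hh.continuous_fderiv one_ne_zero
  have hcont : Continuous fun r : ℝ => fderiv ℝ h (x - r • w) w :=
    (hc'.comp (by fun_prop)).clm_apply continuous_const
  rw [fderiv_avg_apply hh hs, integral_uniformMeasure]
  have := intervalIntegral.integral_eq_sub_of_hasDerivAt (a := 0) (b := 1)
    (fun r _ => (hasDerivAt_comp_segment (w := w) hh x r).neg)
    ((by simpa using hcont.intervalIntegrable 0 1))
  simp only [neg_neg] at this
  rw [this]
  simp only [Pi.neg_apply, one_smul, zero_smul, sub_zero]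
  ring

/-- Integration by parts in r: the weight 1 - r vanishes at r = 1 and has derivative -1. The error
of a uniform average thus becomes a directional derivative of another average of h, which inherits
the bounds on h. -/
lemma fderiv_avg_slopeMeasure (hh : ContDiff ℝ 1 h) (hs : HasCompactSupport h) (x : Space n) :
    fderiv ℝ (avg slopeMeasure w h) x w = h x - avg uniformMeasure w h x := by
  have hc' := hh.continuous_fderiv one_ne_zero
  have hc := hh.continuous
  have hcont : Continuous fun r : ℝ => fderiv ℝ h (x - r • w) w :=
    (hc'.comp (by fun_prop)).clm_apply continuous_const
  have hcont' : Continuous fun r : ℝ => (1 - r) * fderiv ℝ h (x - r • w) w :=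
    (by fun_prop : Continuous fun r : ℝ => 1 - r).mul hcont
  have hcont'' : Continuous fun r : ℝ => h (x - r • w) := by fun_prop
  rw [fderiv_avg_apply hh hs, integral_slopeMeasure, avg, integral_uniformMeasure]
  have hd : ∀ r : ℝ, HasDerivAt (fun r : ℝ => -((1 - r) * h (x - r • w)))
      ((1 - r) * fderiv ℝ h (x - r • w) w + h (x - r • w)) r := by
    intro r
    have := (((hasDerivAt_id r).const_sub 1).mul (hasDerivAt_comp_segment (w := w) hh x r)).neg
    refine this.congr_deriv ?_
    simp
  have := intervalIntegral.integral_eq_sub_of_hasDerivAt (a := 0) (b := 1)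
    (fun r _ => hd r) ((hcont'.add hcont'').intervalIntegrable 0 1)
  rw [intervalIntegral.integral_add (hcont'.intervalIntegrable _ _)
    (hcont''.intervalIntegrable _ _)] at this
  simp at this
  linarith

end Derivative

/-! ### Test functions -/

/-- Smooth compactly supported functions bounded by `1`, with `∫ h² ≤ A`. -/
structure IsTest {n : ℕ} (A : ℝ) (h : Space n → ℝ) : Prop where
  contDiff : ContDiff ℝ ∞ h
  hasCompactSupport : HasCompactSupport h
  abs_le : ∀ x, |h x| ≤ 1
  integral_sq_le : ∫ x, h x ^ 2 ≤ A

section Test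

variable {n : ℕ} {A : ℝ} {h : Space n → ℝ}

lemma IsTest.contDiff_one (hh : IsTest A h) : ContDiff ℝ 1 h := hh.contDiff.of_le (by simp)

lemma IsTest.avg (hh : IsTest A h) {ν : Measure ℝ} (hν : ν Set.univ ≤ 1)
    (hν' : ∀ᵐ r ∂ν, r ∈ Set.Icc (0 : ℝ) 1) (w : Space n) : IsTest A (avg ν w h) := by
  have : IsFiniteMeasure ν := ⟨hν.trans_lt ENNReal.one_lt_top⟩
  exact ⟨contDiff_avg hh.contDiff hh.hasCompactSupport,
    hasCompactSupport_avg hν' hh.hasCompactSupport, fun x => norm_avg_le (F := ℝ) hν hh.abs_le x,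
    (integral_avg_sq_le hν hh.contDiff.continuous hh.hasCompactSupport).trans hh.integral_sq_le⟩

lemma IsTest.uniform (hh : IsTest A h) (w : Space n) : IsTest A (Nucleation.avg uniformMeasure w h) :=
  hh.avg uniformMeasure_univ ae_uniformMeasure w

lemma IsTest.slope (hh : IsTest A h) (w : Space n) : IsTest A (Nucleation.avg slopeMeasure w h) :=
  hh.avg slopeMeasure_univ ae_slopeMeasure w

lemma IsTest.memLp (hh : IsTest A h) (p : ℝ≥0∞) : MemLp h p :=
  hh.contDiff.continuous.memLp_of_hasCompactSupport hh.hasCompactSupport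

lemma fderiv_single {n : ℕ} (h : Space n → ℝ) (x : Space n) (k : Fin n) (b : ℝ) :
    fderiv ℝ h x (EuclideanSpace.single k b) = b * partialDeriv k h x := by
  have : (EuclideanSpace.single k b : Space n) = b • EuclideanSpace.single k 1 := by
    ext i; simp
  rw [this, map_smul, smul_eq_mul, partialDeriv]

lemma contDiff_partialDeriv (hh : ContDiff ℝ ∞ h) (k : Fin n) :
    ContDiff ℝ ∞ (partialDeriv k h) :=
  (hh.fderiv_right (m := ∞) le_rfl).clm_apply contDiff_const

lemma hasCompactSupport_partialDeriv (hs : HasCompactSupport h) (k : Fin n) :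
    HasCompactSupport (partialDeriv k h) :=
  hs.fderiv_apply ℝ _

lemma two_le_infty : (2 : WithTop ℕ∞) ≤ ((⊤ : ℕ∞) : WithTop ℕ∞) := by
  exact WithTop.coe_le_coe.2 (le_top : (2 : ℕ∞) ≤ ⊤)

lemma partialDeriv_comm (hh : ContDiff ℝ ∞ h) (j k : Fin n) :
    partialDeriv j (partialDeriv k h) = partialDeriv k (partialDeriv j h) := by
  funext x
  have hd : DifferentiableAt ℝ (fderiv ℝ h) x :=
    ((hh.fderiv_right (m := ∞) le_rfl).differentiable (by simp)).differentiableAt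
  have key : ∀ j k : Fin n, partialDeriv j (partialDeriv k h) x
      = fderiv ℝ (fderiv ℝ h) x (EuclideanSpace.single j 1) (EuclideanSpace.single k 1) := by
    intro j k
    have := (hd.hasFDerivAt.clm_apply (hasFDerivAt_const (EuclideanSpace.single k (1 : ℝ)) x)).fderiv
    unfold partialDeriv
    rw [this]
    simp
  rw [key, key]
  exact (hh.contDiffAt.isSymmSndFDerivAt (by simpa using two_le_infty)).eq _ _

end Test

lemma abs_integral_mul_le {α : Type*} [MeasurableSpace α] {μ : Measure α} {f g : α → ℝ}
    (hf : MemLp f 2 μ) (hg : MemLp g 2 μ) :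
    |∫ x, f x * g x ∂μ| ≤ √(∫ x, f x ^ 2 ∂μ) * √(∫ x, g x ^ 2 ∂μ) := by
  have h := integral_mul_norm_le_Lp_mul_Lq (μ := μ) (f := f) (g := g) Real.HolderConjugate.two_two
    (by simpa using hf) (by simpa using hg)
  simp only [Real.norm_eq_abs, Real.rpow_ofNat, sq_abs] at h
  rw [Real.sqrt_eq_rpow, Real.sqrt_eq_rpow]
  refine le_trans ?_ h
  refine (abs_integral_le_integral_abs).trans_eq ?_
  simp [abs_mul]

/-- A directional average in the `k`-th direction gains an integration in the `k`-th variable. -/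
lemma avg_le_lmarginal_insert {n : ℕ} {h : Space n → ℝ} (hc : Continuous h)
    {F : (Fin n → ℝ) → ℝ≥0∞} (hF : Measurable F) {w : Fin n → ℝ} {k : Fin n} (hw : 0 < w k)
    {s : Finset (Fin n)} (hk : k ∉ s)
    (hs : ∀ x, ENNReal.ofReal |h x| * ∏ i ∈ s, ENNReal.ofReal (w i)
      ≤ lmarginal (fun _ => volume) s F x) (x : Space n) :
    ENNReal.ofReal |avg uniformMeasure (EuclideanSpace.single k (w k)) h x|
      * ∏ i ∈ insert k s, ENNReal.ofReal (w i) ≤ lmarginal (fun _ => volume) (insert k s) F x := by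
  set P := ∏ i ∈ s, ENNReal.ofReal (w i) with hP
  set H : ℝ → ℝ≥0∞ := fun y => ENNReal.ofReal |h (WithLp.toLp 2 (Function.update (x : Fin n → ℝ) k y))|
    with hH
  have hHm : Measurable H := by
    have : Continuous fun y : ℝ => h (WithLp.toLp 2 (Function.update (x : Fin n → ℝ) k y)) :=
      hc.comp ((PiLp.continuous_toLp 2 _).comp (continuous_const.update k continuous_id))
    exact (ENNReal.continuous_ofReal.comp this.abs).measurable
  have hx : ∀ r : ℝ, x - r • EuclideanSpace.single k (w k)
      = WithLp.toLp 2 (Function.update (x : Fin n → ℝ) k (x k - r * w k)) := by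
    intro r
    ext i
    by_cases hi : i = k
    · subst hi; simp
    · simp [hi]
  have h1 : ENNReal.ofReal |avg uniformMeasure (EuclideanSpace.single k (w k)) h x|
      ≤ ∫⁻ r, H (x k - r * w k) := by
    rw [← Real.enorm_eq_ofReal_abs]
    refine (enorm_integral_le_lintegral_enorm _).trans ?_
    refine le_trans ?_ (setLIntegral_le_lintegral (Set.Ioc 0 1) _)
    refine lintegral_mono fun r => ?_
    rw [Real.enorm_eq_ofReal_abs, hx r]
  -- The substitution y = x k - r * w k, after the unit interval has been enlarged to the whole
  -- line; its Jacobian supplies the new factor w k.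
  have h2 : (∫⁻ r, H (x k - r * w k)) * ENNReal.ofReal (w k) = ∫⁻ y, H y := by
    have e1 : ∫⁻ r, H (x k - r * w k) = ∫⁻ r, (fun y => H (x k - y)) r
        ∂(Measure.map (fun r => r * w k) volume) := by
      rw [lintegral_map (by fun_prop) (by fun_prop)]
    rw [e1, Real.map_volume_mul_right hw.ne', lintegral_smul_measure,
      lintegral_sub_left_eq_self, abs_of_pos (inv_pos.2 hw), smul_eq_mul, mul_right_comm,
      ← ENNReal.ofReal_mul (inv_pos.2 hw).le, inv_mul_cancel₀ hw.ne', ENNReal.ofReal_one, one_mul]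
  rw [Finset.prod_insert hk, ← mul_assoc, lmarginal_insert _ hF hk]
  calc _ ≤ (∫⁻ y, H y) * P := by rw [← h2]; gcongr
    _ = ∫⁻ y, H y * P := (lintegral_mul_const _ hHm).symm
    _ ≤ _ := lintegral_mono fun y => hs _

/-- Successive averages in the directions of `s`, along which a functional varies little. -/
lemma exists_isTest_lmarginal {n : ℕ} {A : ℝ} {g : Space n → ℝ} (hg : IsTest A g)
    {w : Fin n → ℝ} (hw : ∀ k, 0 < w k) (Λ : (Space n → ℝ) → ℝ) (c : ℝ) (s : Finset (Fin n))
    (hΛ : ∀ k ∈ s, ∀ h, IsTest A h →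
      |Λ h - Λ (avg uniformMeasure (EuclideanSpace.single k (w k)) h)| ≤ c) :
    ∃ h, IsTest A h ∧ |Λ g - Λ h| ≤ s.card * c ∧
      ∀ x : Space n, ENNReal.ofReal |h x| * ∏ i ∈ s, ENNReal.ofReal (w i)
        ≤ lmarginal (fun _ => volume) s (fun y => ENNReal.ofReal |g (WithLp.toLp 2 y)|) x := by
  have hgm : Measurable fun y : Fin n → ℝ => ENNReal.ofReal |g (WithLp.toLp 2 y)| :=
    (ENNReal.continuous_ofReal.comp
      (hg.contDiff.continuous.comp (PiLp.continuous_toLp 2 _)).abs).measurable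
  induction s using Finset.induction_on with
  | empty => exact ⟨g, hg, by simp, by simp⟩
  | insert k s hk ih =>
    obtain ⟨h, hh, hd, hb⟩ := ih fun k hk => hΛ k (Finset.mem_insert_of_mem hk)
    refine ⟨_, hh.uniform (EuclideanSpace.single k (w k)), ?_,
      avg_le_lmarginal_insert hh.contDiff.continuous hgm (hw k) hk hb⟩
    have h1 := hΛ k (Finset.mem_insert_self _ _) h hh
    rw [Finset.card_insert_of_notMem hk]
    push_cast
    calc _ ≤ |Λ g - Λ h| + |Λ h - Λ (avg uniformMeasure (EuclideanSpace.single k (w k)) h)| :=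
          abs_sub_le _ _ _
      _ ≤ _ := by linarith

/-- When every variable has been integrated out, the marginal is the L¹ norm of g, so the supremum
is at most that norm over the volume of the box. -/
lemma abs_le_of_lmarginal_univ {n : ℕ} {g h : Space n → ℝ} {B : ℝ} (hB : 0 ≤ B)
    (hg : Continuous g) (hgi : Integrable g) (hgB : ∫ x, |g x| ≤ B) {w : Fin n → ℝ} (hw : ∀ k, 0 < w k)
    (hh : ∀ x : Space n, ENNReal.ofReal |h x| * ∏ i, ENNReal.ofReal (w i)
        ≤ lmarginal (fun _ => volume) Finset.univ (fun y => ENNReal.ofReal |g (WithLp.toLp 2 y)|) x)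
    (x : Space n) : |h x| ≤ B / ∏ i, w i := by
  have h1 := hh x
  have hpos : 0 < ∏ i, w i := Finset.prod_pos fun i _ => hw i
  have h2 : ∫⁻ y : Fin n → ℝ, ENNReal.ofReal |g (WithLp.toLp 2 y)| = ENNReal.ofReal (∫ x, |g x|) := by
    rw [ofReal_integral_eq_lintegral_ofReal hgi.abs (.of_forall fun x => abs_nonneg _)]
    exact (PiLp.volume_preserving_toLp (Fin n)).lintegral_comp
      (f := fun x : Space n => ENNReal.ofReal |g x|)
      (ENNReal.continuous_ofReal.comp hg.abs).measurable
  rw [lmarginal_univ, ← ENNReal.ofReal_prod_of_nonneg fun i _ => (hw i).le, ← volume_pi, h2,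
    ← ENNReal.ofReal_mul (abs_nonneg _)] at h1
  rw [le_div_iff₀ hpos]
  exact (ENNReal.ofReal_le_ofReal_iff hB).1 (h1.trans (ENNReal.ofReal_le_ofReal hgB))

/-! ### Estimates for averages -/

/-- Test the total variation with a field whose only nonzero component is ψ, in position (i, j, k).
-/
lemma integral_mul_partialDeriv_le {n : ℕ} {χ : Space n → Mat n} {P : ℝ} (hP0 : 0 ≤ P)
    (hP : totalVariation χ ≤ ENNReal.ofReal P) (i j k : Fin n) {ψ : Space n → ℝ}
    (hψ : ContDiff ℝ 1 ψ) (hs : HasCompactSupport ψ) (h1 : ∀ x, |ψ x| ≤ 1) :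
    ∫ x, χ x i j * partialDeriv k ψ x ≤ P := by
  set c : Fin n → Fin n → Fin n → ℝ := Pi.single i (Pi.single j (Pi.single k 1)) with hc
  have hd : ∀ x, HasFDerivAt (fun x => ψ x • c) ((fderiv ℝ ψ x).smulRight c) x := fun x =>
    ((hψ.differentiable one_ne_zero).differentiableAt.hasFDerivAt).smul_const c
  have key := (le_iSup₂_of_le (f := fun (φ : Space n → Fin n → Fin n → Fin n → ℝ)
      (_ : ContDiff ℝ 1 φ) => ⨆ (_ : HasCompactSupport φ)
      (_ : ∀ x, ∑ i, ∑ j, ∑ k, φ x i j k ^ 2 ≤ 1),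
      ENNReal.ofReal (∑ i, ∑ j, ∫ x, χ x i j * ∑ k, partialDeriv k φ x i j k))
    (fun x => ψ x • c) (hψ.smul contDiff_const) (le_iSup₂_of_le hs.smul_right ?_ le_rfl)).trans hP
  · have hp : ∀ (x : Space n) (i' j' k' : Fin n), partialDeriv k' (fun x => ψ x • c) x i' j' k'
        = partialDeriv k' ψ x * c i' j' k' := by
      intro x i' j' k'
      simp [partialDeriv, (hd x).fderiv]
    simp_rw [hp] at key
    have hsum : ∑ i', ∑ j', ∫ x, χ x i' j' * ∑ k', partialDeriv k' ψ x * c i' j' k'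
        = ∫ x, χ x i j * partialDeriv k ψ x := by
      rw [Finset.sum_eq_single i, Finset.sum_eq_single j]
      · refine integral_congr_ae (.of_forall fun x => ?_)
        simp only [hc, Pi.single_eq_same]
        rw [Finset.sum_eq_single k] <;> simp +contextual
      · intro j' _ hj; simp [hc, hj]
      · simp
      · intro i' _ hi; simp [hc, hi]
      · simp
    rw [hsum] at key
    exact (ENNReal.ofReal_le_ofReal_iff hP0).1 key
  · intro x
    have : ∑ i', ∑ j', ∑ k', (ψ x • c) i' j' k' ^ 2 = ψ x ^ 2 := by
      rw [Finset.sum_eq_single i, Finset.sum_eq_single j, Finset.sum_eq_single k]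
      · simp [hc]
      · intro k' _ hk; simp [hc, hk]
      · simp
      · intro j' _ hj; simp [hc, hj]
      · simp
      · intro i' _ hi; simp [hc, hi]
      · simp
    rw [this]
    exact (sq_le_one_iff_abs_le_one _).2 (h1 x)

lemma abs_integral_mul_partialDeriv_le {n : ℕ} {χ : Space n → Mat n} {P : ℝ} (hP0 : 0 ≤ P)
    (hP : totalVariation χ ≤ ENNReal.ofReal P) (i j k : Fin n) {ψ : Space n → ℝ}
    (hψ : ContDiff ℝ 1 ψ) (hs : HasCompactSupport ψ) (h1 : ∀ x, |ψ x| ≤ 1) :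
    |∫ x, χ x i j * partialDeriv k ψ x| ≤ P := by
  refine abs_le'.2 ⟨integral_mul_partialDeriv_le hP0 hP i j k hψ hs h1, ?_⟩
  have := integral_mul_partialDeriv_le hP0 hP i j k (ψ := fun x => -ψ x) hψ.neg hs.neg
    (by simpa using h1)
  have hn : ∀ x, partialDeriv k (fun x => -ψ x) x = -partialDeriv k ψ x := by
    intro x; simp [partialDeriv]
  simpa [hn, integral_neg] using this

lemma IsTest.integrable_mul {n : ℕ} {A : ℝ} {f h : Space n → ℝ} (hh : IsTest A h)
    (hf : Integrable f) : Integrable (fun x => f x * h x) :=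
  hf.mul_bdd hh.contDiff.continuous.aestronglyMeasurable (c := 1) (.of_forall hh.abs_le)

/-- The difference of h and its average is a times a partial derivative of the slope average, which
is still bounded by 1. -/
lemma abs_integral_sub_avg_le_totalVariation {n : ℕ} {χ : Space n → Mat n} {P : ℝ} (hP0 : 0 ≤ P)
    (hP : totalVariation χ ≤ ENNReal.ofReal P) (i j k : Fin n)
    (hχ : Integrable fun x => χ x i j) {A : ℝ} {h : Space n → ℝ} (hh : IsTest A h) {a : ℝ}
    (ha : 0 < a) :
    |(∫ x, χ x i j * h x) - ∫ x, χ x i j * avg uniformMeasure (EuclideanSpace.single k a) h x|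
      ≤ a * P := by
  have hT := hh.slope (EuclideanSpace.single k a)
  rw [← integral_sub (hh.integrable_mul hχ) ((hh.uniform _).integrable_mul hχ)]
  have : ∀ x, χ x i j * h x - χ x i j * avg uniformMeasure (EuclideanSpace.single k a) h x
      = a * (χ x i j * partialDeriv k (avg slopeMeasure (EuclideanSpace.single k a) h) x) := by
    intro x
    have := fderiv_avg_slopeMeasure (w := EuclideanSpace.single k a) hh.contDiff_one
      hh.hasCompactSupport x
    rw [fderiv_single] at this
    rw [← mul_sub, ← this]
    ring
  simp_rw [this]
  rw [integral_const_mul, abs_mul, abs_of_pos ha]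
  gcongr
  exact abs_integral_mul_partialDeriv_le hP0 hP i j k hT.contDiff_one hT.hasCompactSupport
    hT.abs_le

lemma integral_sub_sq_le {n : ℕ} {A : ℝ} {h h' : Space n → ℝ} (hh : MemLp h 2) (hh' : MemLp h' 2)
    (hA : ∫ x, h x ^ 2 ≤ A) (hA' : ∫ x, h' x ^ 2 ≤ A) : ∫ x, (h x - h' x) ^ 2 ≤ 4 * A := by
  calc ∫ x, (h x - h' x) ^ 2 ≤ ∫ x, (2 * h x ^ 2 + 2 * h' x ^ 2) := by
        refine integral_mono_of_nonneg (.of_forall fun x => sq_nonneg _)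
          ((hh.integrable_sq.const_mul 2).add (hh'.integrable_sq.const_mul 2))
          (.of_forall fun x => ?_)
        dsimp only
        nlinarith [sq_nonneg (h x + h' x)]
    _ = 2 * (∫ x, h x ^ 2) + 2 * ∫ x, h' x ^ 2 := by
        rw [integral_add (hh.integrable_sq.const_mul 2) (hh'.integrable_sq.const_mul 2),
          integral_const_mul, integral_const_mul]
    _ ≤ _ := by linarith

lemma abs_integral_mul_sub_le {n : ℕ} {A E : ℝ} {f h h' : Space n → ℝ} (hf : MemLp f 2)
    (hE : ∫ x, f x ^ 2 ≤ E) (hh : MemLp h 2) (hh' : MemLp h' 2)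
    (hA : ∫ x, h x ^ 2 ≤ A) (hA' : ∫ x, h' x ^ 2 ≤ A) :
    |∫ x, f x * (h x - h' x)| ≤ 2 * (√E * √A) := by
  have h1 := abs_integral_mul_le hf (hh.sub hh')
  have h2 : √(∫ x, (h x - h' x) ^ 2) ≤ 2 * √A := by
    refine (Real.sqrt_le_sqrt (integral_sub_sq_le hh hh' hA hA')).trans_eq ?_
    rw [Real.sqrt_mul (by norm_num), show (4 : ℝ) = 2 ^ 2 by norm_num, Real.sqrt_sq (by norm_num)]
  calc _ ≤ √(∫ x, f x ^ 2) * √(∫ x, (h x - h' x) ^ 2) := h1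
    _ ≤ √E * (2 * √A) := by gcongr
    _ = _ := by ring

/-- Interchanging the weak derivatives of `u`. -/
lemma IsH1WithGradient.integral_mul_partialDeriv_comm {n : ℕ} {u : Space n → Space n}
    {G : Space n → Mat n} (hu : IsH1WithGradient u G) {φ : Space n → ℝ} (hφ : ContDiff ℝ ∞ φ)
    (hs : HasCompactSupport φ) (i j k : Fin n) :
    ∫ x, G x i j * partialDeriv k φ x = ∫ x, G x i k * partialDeriv j φ x := by
  have h1 := hu.integral_by_parts _ (contDiff_partialDeriv hφ k)
    (hasCompactSupport_partialDeriv hs k) i j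
  have h2 := hu.integral_by_parts _ (contDiff_partialDeriv hφ j)
    (hasCompactSupport_partialDeriv hs j) i k
  rw [partialDeriv_comm hφ] at h1
  linarith

/-- Replace f by G i j at the cost of the elastic error. The increment in direction k is b ∂ₖφ, and
the symmetry of second derivatives trades G i j ∂ₖφ for G i k ∂ⱼφ. Since φ is itself an average over
length a in direction j, a ∂ⱼφ is a finite difference, whence the factor b / a. -/
lemma abs_integral_sub_avg_le_elastic {n : ℕ} {u : Space n → Space n} {G : Space n → Mat n}
    (hu : IsH1WithGradient u G) {i j k : Fin n} {f : Space n → ℝ} (hf : MemLp f 2) {E A : ℝ}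
    (hEj : ∫ x, (G x i j - f x) ^ 2 ≤ E) (hEk : ∫ x, G x i k ^ 2 ≤ E) {h : Space n → ℝ}
    (hh : IsTest A h) {a b : ℝ} (ha : 0 < a) (hb : 0 < b) :
    |(∫ x, f x * avg uniformMeasure (EuclideanSpace.single j a) h x)
      - ∫ x, f x * avg uniformMeasure (EuclideanSpace.single j a)
          (avg uniformMeasure (EuclideanSpace.single k b) h) x|
      ≤ 2 * (1 + b / a) * (√E * √A) := by
  set ej : Space n := EuclideanSpace.single j a
  set ek : Space n := EuclideanSpace.single k b
  have hc := hh.contDiff.continuous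
  have hs := hh.hasCompactSupport
  rw [avg_comm (w := ej) (w' := ek) hc hs]
  set p := avg uniformMeasure ej h with hp
  have hpt : IsTest A p := hh.uniform ej
  set m := avg slopeMeasure ek h with hm
  have hmt : IsTest A m := hh.slope ek
  set φ := avg slopeMeasure ek p with hφ
  have hφt : IsTest A φ := hpt.slope ek
  have hφ' : φ = avg uniformMeasure ej m := avg_comm hc hs
  have hdk : ∀ x, b * partialDeriv k φ x = p x - avg uniformMeasure ek p x := fun x => by
    rw [← fderiv_single, hφ, fderiv_avg_slopeMeasure hpt.contDiff_one hpt.hasCompactSupport]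
  have hdj : ∀ x, a * partialDeriv j φ x = m x - m (x - ej) := fun x => by
    rw [← fderiv_single, hφ', fderiv_avg_uniformMeasure hmt.contDiff_one hmt.hasCompactSupport]
  have hqt : IsTest A (avg uniformMeasure ek p) := hpt.uniform ek
  have hGj := hu.memLp_gradient i j
  have hGk := hu.memLp_gradient i k
  have hpq : MemLp (fun x => p x - avg uniformMeasure ek p x) 2 := (hpt.memLp 2).sub (hqt.memLp 2)
  have e1 : (∫ x, f x * p x) - ∫ x, f x * avg uniformMeasure ek p x
      = b / a * (∫ x, G x i k * (m x - m (x - ej)))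
        - ∫ x, (G x i j - f x) * (p x - avg uniformMeasure ek p x) := by
    -- The exchange of derivatives j and k, with both written as differences of averages.
    have h1 : b / a * (∫ x, G x i k * (m x - m (x - ej)))
        = ∫ x, G x i j * (p x - avg uniformMeasure ek p x) := by
      simp_rw [← hdj, ← hdk, mul_left_comm _ a, mul_left_comm _ b]
      rw [integral_const_mul, integral_const_mul,
        hu.integral_mul_partialDeriv_comm hφt.contDiff hφt.hasCompactSupport i j k]
      field_simp
    have i1 : Integrable (fun x => f x * p x) := hf.integrable_mul (hpt.memLp 2)
    have i2 : Integrable (fun x => f x * avg uniformMeasure ek p x) :=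
      hf.integrable_mul (hqt.memLp 2)
    have i3 : Integrable (fun x => G x i j * (p x - avg uniformMeasure ek p x)) :=
      hGj.integrable_mul hpq
    have i4 : Integrable (fun x => (G x i j - f x) * (p x - avg uniformMeasure ek p x)) :=
      (hGj.sub hf).integrable_mul hpq
    rw [h1, ← integral_sub i1 i2, ← integral_sub i3 i4]
    refine integral_congr_ae (.of_forall fun x => ?_)
    dsimp only
    ring
  have b1 : |∫ x, G x i k * (m x - m (x - ej))| ≤ 2 * (√E * √A) := by
    refine abs_integral_mul_sub_le hGk hEk (hmt.memLp 2)
      ((hmt.memLp 2).comp_measurePreserving (measurePreserving_sub_right volume ej))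
      hmt.integral_sq_le ?_
    rw [integral_sub_right_eq_self (fun x => m x ^ 2) ej]
    exact hmt.integral_sq_le
  have b2 : |∫ x, (G x i j - f x) * (p x - avg uniformMeasure ek p x)| ≤ 2 * (√E * √A) :=
    abs_integral_mul_sub_le (hGj.sub hf) hEj (hpt.memLp 2) (hqt.memLp 2) hpt.integral_sq_le
      hqt.integral_sq_le
  rw [e1]
  refine (abs_sub _ _).trans ?_
  rw [abs_mul, abs_of_pos (div_pos hb ha)]
  have := mul_le_mul_of_nonneg_left b1 (div_pos hb ha).le
  linarith

/-! ### Lower bound -/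

open Filter Topology in
/-- Approximation of a bounded integrable function by test functions. -/
lemma exists_isTest_approx {n : ℕ} {f : Space n → ℝ} (hf : Integrable f) (h1 : ∀ᵐ x, |f x| ≤ 1)
    {V : ℝ} (hV : ∫ x, |f x| ≤ V) {η : ℝ} (hη : η < ∫ x, f x ^ 2) :
    ∃ g, IsTest V g ∧ ∫ x, |g x| ≤ V ∧ η < ∫ x, f x * g x := by
  obtain ⟨f', hf'm, hff'⟩ := hf.aestronglyMeasurable
  -- A test function needs |g| ≤ 1 everywhere, whereas f has this only almost everywhere; hence the
  -- truncation of a measurable representative.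
  set q : Space n → ℝ := fun x => max (-1) (min 1 (f' x)) with hq
  have hqm : StronglyMeasurable q :=
    stronglyMeasurable_const.sup (stronglyMeasurable_const.inf hf'm)
  have hq1 : ∀ x, |q x| ≤ 1 := fun x => abs_le.2 ⟨le_max_left _ _, max_le (by norm_num) (min_le_left _ _)⟩
  have hqf : q =ᵐ[volume] f := by
    filter_upwards [h1, hff'] with x hx hx'
    simp only [hq, ← hx']
    rw [abs_le] at hx
    rw [min_eq_right hx.2, max_eq_right hx.1]
  have hqi : Integrable q := hf.congr hqf.symm
  have hfq : Integrable (fun x => f x * q x) := hf.mul_bdd hqi.1 (c := 1) (.of_forall hq1)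
  have hfq2 : ∫ x, f x ^ 2 = ∫ x, f x * q x := by
    refine integral_congr_ae ?_
    filter_upwards [hqf] with x hx
    rw [hx, pow_two]
  have hball : Tendsto (fun m : ℕ => ∫ x in Metric.closedBall (0 : Space n) m, f x * q x) atTop
      (𝓝 (∫ x, f x * q x)) := by
    have := tendsto_setIntegral_of_monotone (μ := volume) (f := fun x => f x * q x)
      (s := fun m : ℕ => Metric.closedBall (0 : Space n) m) (fun m => measurableSet_closedBall)
      (fun a b hab => Metric.closedBall_subset_closedBall (by exact_mod_cast hab)) hfq.integrableOn
    rwa [Metric.iUnion_closedBall_nat, Measure.restrict_univ] at this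
  rw [hfq2] at hη
  obtain ⟨R, hR⟩ := (hball.eventually (lt_mem_nhds hη)).exists
  set F : Space n → ℝ := (Metric.closedBall (0 : Space n) R).indicator q with hF
  have hFi : Integrable F := hqi.indicator measurableSet_closedBall
  have hF1 : ∀ x, |F x| ≤ 1 := fun x => by
    by_cases hx : x ∈ Metric.closedBall (0 : Space n) R
    · simpa [hF, hx] using hq1 x
    · simp [hF, Set.indicator_of_notMem hx]
  have hFs : HasCompactSupport F :=
    HasCompactSupport.intro (isCompact_closedBall (0 : Space n) R) fun x hx =>
      Set.indicator_of_notMem hx _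
  have hFV : ∫ x, |F x| ≤ V := by
    refine le_trans ?_ hV
    refine integral_mono_ae hFi.abs hf.abs ?_
    filter_upwards [hqf] with x hx
    rw [← hx]
    by_cases hx : x ∈ Metric.closedBall (0 : Space n) R
    · simp [hF, hx]
    · simp [hF, Set.indicator_of_notMem hx]
  have hFR : η < ∫ x, f x * F x := by
    rw [← integral_indicator measurableSet_closedBall] at hR
    refine hR.trans_eq (integral_congr_ae (.of_forall fun x => ?_))
    by_cases hx : x ∈ Metric.closedBall (0 : Space n) R
    · simp [hF, hx]
    · simp [hF, Set.indicator_of_notMem hx]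
  -- Mollification preserves the sup bound and the L¹ bound. Outer and inner radii keep the ratio 2,
  -- as almost everywhere convergence of the mollifications requires.
  set φ : ℕ → ContDiffBump (0 : Space n) := fun m =>
    ⟨1 / (m + 1), 2 / (m + 1), by positivity, by gcongr; norm_num⟩ with hφ
  set g : ℕ → Space n → ℝ := fun m =>
    convolution ((φ m).normed volume) F (ContinuousLinearMap.lsmul ℝ ℝ) volume with hg
  have hconv : ∀ᵐ x, Tendsto (fun m => g m x) atTop (𝓝 (F x)) := by
    refine ContDiffBump.ae_convolution_tendsto_right_of_locallyIntegrable (K := 2) ?_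
      (.of_forall fun m => ?_) hFi.locallyIntegrable
    · simpa [hφ, Function.comp_def] using
        (tendsto_const_div_atTop_nhds_zero_nat (2 : ℝ)).comp (tendsto_add_atTop_nat 1)
    · simp only [hφ]
      apply le_of_eq
      ring
  have hφi : ∀ m, Integrable ((φ m).normed volume) := fun m => (φ m).integrable_normed
  have hce : ∀ m, ConvolutionExists ((φ m).normed volume) F (ContinuousLinearMap.lsmul ℝ ℝ) volume :=
    fun m => (φ m).hasCompactSupport_normed.convolutionExists_left _
      (φ m).continuous_normed hFi.locallyIntegrable
  have hce' : ∀ m, ConvolutionExists ((φ m).normed volume) (fun x => |F x|)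
      (ContinuousLinearMap.lsmul ℝ ℝ) volume :=
    fun m => (φ m).hasCompactSupport_normed.convolutionExists_left _
      (φ m).continuous_normed hFi.abs.locallyIntegrable
  have hle : ∀ m x, |g m x| ≤ convolution ((φ m).normed volume) (fun x => |F x|)
      (ContinuousLinearMap.lsmul ℝ ℝ) volume x := by
    intro m x
    refine (abs_integral_le_integral_abs).trans_eq ?_
    refine integral_congr_ae (.of_forall fun t => ?_)
    simp [abs_mul, abs_of_nonneg ((φ m).nonneg_normed t)]
  have hg1 : ∀ m x, |g m x| ≤ 1 := by
    intro m x
    refine (hle m x).trans ?_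
    rw [← (φ m).integral_normed (μ := volume)]
    refine integral_mono (hce' m x) (hφi m) fun t => ?_
    simpa using mul_le_of_le_one_right ((φ m).nonneg_normed t) (hF1 _)
  have hgc : ∀ m, ContDiff ℝ ∞ (g m) := fun m =>
    (φ m).hasCompactSupport_normed.contDiff_convolution_left _ (φ m).contDiff_normed
      hFi.locallyIntegrable
  have hgs : ∀ m, HasCompactSupport (g m) := fun m =>
    HasCompactSupport.convolution _ (φ m).hasCompactSupport_normed hFs
  have hgi : ∀ m, Integrable (g m) := fun m =>
    (hgc m).continuous.integrable_of_hasCompactSupport (hgs m)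
  have hgV : ∀ m, ∫ x, |g m x| ≤ V := by
    intro m
    refine le_trans (integral_mono (hgi m).abs
      ((hφi m).integrable_convolution (ContinuousLinearMap.lsmul ℝ ℝ) hFi.abs) (hle m)) ?_
    rw [integral_convolution _ (hφi m) hFi.abs, (φ m).integral_normed]
    simpa using hFV
  have hlim : Tendsto (fun m => ∫ x, f x * g m x) atTop (𝓝 (∫ x, f x * F x)) := by
    refine tendsto_integral_of_dominated_convergence (fun x => |f x|)
      (fun m => hf.1.mul (hgc m).continuous.aestronglyMeasurable) hf.abs
      (fun m => .of_forall fun x => ?_) ?_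
    · rw [norm_mul]
      exact mul_le_of_le_one_right (norm_nonneg _) (hg1 m x)
    · filter_upwards [hconv] with x hx using hx.const_mul _
  obtain ⟨m, hm⟩ := (hlim.eventually (lt_mem_nhds hFR)).exists
  refine ⟨g m, ⟨hgc m, hgs m, hg1 m, le_trans ?_ (hgV m)⟩, hgV m, hm⟩
  refine integral_mono_of_nonneg (.of_forall fun x => sq_nonneg _) (hgi m).abs (.of_forall fun x => ?_)
  dsimp only
  rw [← sq_abs, pow_two]
  exact mul_le_of_le_one_left (abs_nonneg _) (hg1 m x)

lemma integral_mul_le_of_bound {n : ℕ} {f h : Space n → ℝ} (hf : Integrable f) {V B : ℝ}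
    (hB : 0 ≤ B) (hV : ∫ x, |f x| ≤ V) (hb : ∀ x, |h x| ≤ B) :
    |∫ x, f x * h x| ≤ V * B := by
  refine (norm_integral_le_of_norm_le (f := fun x => f x * h x) (hf.abs.mul_const B) (.of_forall fun x => ?_)).trans ?_
  · rw [norm_mul]
    exact mul_le_mul_of_nonneg_left (hb x) (norm_nonneg _)
  · rw [integral_mul_const]
    gcongr

/-! ### Pairing bounds obtained by averaging over boxes -/

section Core

variable {n : ℕ} {χ : Space n → Mat n} {i : Fin n} {P V : ℝ} {g : Space n → ℝ}

/-- The isoperimetric estimate. -/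
lemma integral_mul_le_isotropic (hP0 : 0 ≤ P) (hP : totalVariation χ ≤ ENNReal.ofReal P)
    (hχ : Integrable fun x => χ x i i) (hV : ∫ x, |χ x i i| ≤ V) (hg : IsTest V g)
    (hgV : ∫ x, |g x| ≤ V) {a : ℝ} (ha : 0 < a) :
    ∫ x, χ x i i * g x ≤ n * (a * P) + V * (V / a ^ n) := by
  have hV0 : 0 ≤ V := (integral_nonneg fun x => abs_nonneg _).trans hV
  obtain ⟨h, hh, hd, hb⟩ := exists_isTest_lmarginal hg (w := fun _ => a) (fun _ => ha)
    (fun h => ∫ x, χ x i i * h x) (a * P) Finset.univ fun k _ h hh =>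
      abs_integral_sub_avg_le_totalVariation hP0 hP i i k hχ hh ha
  have hgi : Integrable g :=
    hg.contDiff.continuous.integrable_of_hasCompactSupport hg.hasCompactSupport
  have hbd := abs_le_of_lmarginal_univ hV0 hg.contDiff.continuous hgi hgV (fun _ => ha) hb
  simp only [Finset.prod_const, Finset.card_univ, Fintype.card_fin] at hbd hd
  have h3 := integral_mul_le_of_bound hχ (by positivity) hV hbd
  linarith [abs_le.1 hd, abs_le.1 h3]

/-- Only the average of length a in direction i is charged to the surface energy; the transverse
ones, of length b, are charged to the elastic energy. -/
lemma integral_mul_le_anisotropic (hP0 : 0 ≤ P) (hP : totalVariation χ ≤ ENNReal.ofReal P)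
    (hχ : Integrable fun x => χ x i i) (hχ2 : MemLp (fun x => χ x i i) 2)
    (hV : ∫ x, |χ x i i| ≤ V) {u : Space n → Space n} {G : Space n → Mat n}
    (hu : IsH1WithGradient u G) {E : ℝ} (hE : ∫ x, (G x i i - χ x i i) ^ 2 ≤ E)
    (hE' : ∀ k, k ≠ i → ∫ x, G x i k ^ 2 ≤ E) (hg : IsTest V g)
    (hgV : ∫ x, |g x| ≤ V) {a b : ℝ} (ha : 0 < a) (hb : 0 < b) :
    ∫ x, χ x i i * g x
      ≤ a * P + n * (2 * (1 + b / a) * (√E * √V)) + V * (V / (a * b ^ (n - 1))) := by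
  have hV0 : 0 ≤ V := (integral_nonneg fun x => abs_nonneg _).trans hV
  set w : Fin n → ℝ := fun k => if k = i then a else b with hw
  have hwpos : ∀ k, 0 < w k := fun k => by by_cases h : k = i <;> simp [hw, h, ha, hb]
  have hwi : w i = a := by simp [hw]
  have hwk : ∀ k, k ≠ i → w k = b := fun k hk => by simp [hw, hk]
  have hni : i ∉ Finset.univ.erase i := by simp
  have hprod : ∏ k, w k = a * b ^ (n - 1) := by
    rw [← Finset.mul_prod_erase _ _ (Finset.mem_univ i), hwi,
      Finset.prod_congr rfl (fun k hk => hwk k (Finset.ne_of_mem_erase hk))]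
    simp
  -- The functional already contains the axial average, which the elastic estimate needs. That
  -- average enters the sup bound afterwards, through `hbd'`.
  obtain ⟨h, hh, hd, hbd⟩ := exists_isTest_lmarginal hg hwpos
    (fun h => ∫ x, χ x i i * avg uniformMeasure (EuclideanSpace.single i a) h x)
    (2 * (1 + b / a) * (√E * √V)) (Finset.univ.erase i) fun k hk h hh => by
      have hk := Finset.ne_of_mem_erase hk
      rw [hwk k hk]
      exact abs_integral_sub_avg_le_elastic hu hχ2 hE (hE' k hk) hh ha hb
  have hgi : Integrable g :=
    hg.contDiff.continuous.integrable_of_hasCompactSupport hg.hasCompactSupport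
  have hgm : Measurable fun y : Fin n → ℝ => ENNReal.ofReal |g (WithLp.toLp 2 y)| :=
    (ENNReal.continuous_ofReal.comp
      (hg.contDiff.continuous.comp (PiLp.continuous_toLp 2 _)).abs).measurable
  have hbd' := avg_le_lmarginal_insert hh.contDiff.continuous hgm (hwpos i) hni hbd
  rw [Finset.insert_erase (Finset.mem_univ i)] at hbd'
  have hbd'' := abs_le_of_lmarginal_univ hV0 hg.contDiff.continuous hgi hgV hwpos hbd'
  rw [hprod, hwi] at hbd''
  have h3 := integral_mul_le_of_bound hχ (by positivity) hV hbd''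
  have h0 := abs_integral_sub_avg_le_totalVariation hP0 hP i i i hχ hg ha
  have hcard : ((Finset.univ.erase i).card : ℝ) ≤ n := by
    exact_mod_cast (Finset.card_le_univ _).trans_eq (by simp)
  have hd' := hd.trans (mul_le_mul_of_nonneg_right hcard (by positivity))
  linarith [abs_le.1 hd', abs_le.1 h3, abs_le.1 h0]

end Core

/-! ### The optimal scales -/

/-- The optimal width `L` and height `H` of an inclusion of volume `V`. -/
lemma exists_scales {n : ℕ} (hn : 2 ≤ n) {ε V : ℝ} (hε : 0 < ε) (hV : 0 < V) :
    ∃ L H : ℝ, 0 < L ∧ L ≤ H ∧ L * H ^ (n - 1) = V ∧ scalingRate n ε V = ε * H ^ (n - 1) ∧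
      L ^ 2 / H ^ 2 * V ≤ scalingRate n ε V ∧
      (L = H ∨ L ^ 2 / H ^ 2 * V = scalingRate n ε V) := by
  obtain ⟨m, rfl⟩ : ∃ m, n = m + 1 := ⟨n - 1, by omega⟩
  have hm : 1 ≤ m := by omega
  simp only [Nat.add_sub_cancel]
  by_cases hc : V ≤ ε ^ (m + 1)
  · set H := V ^ (((m + 1 : ℕ) : ℝ)⁻¹) with hH
    have hH0 : 0 < H := Real.rpow_pos_of_pos hV _
    have hHV : H ^ (m + 1) = V := Real.rpow_inv_natCast_pow hV.le (by omega)
    have hr : scalingRate (m + 1) ε V = ε * H ^ m := by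
      rw [scalingRate, if_pos hc, hH, ← Real.rpow_mul_natCast hV.le]
      congr 2
      push_cast
      field_simp
      ring
    have hHε : H ≤ ε := by
      rw [← hHV] at hc
      exact (pow_le_pow_iff_left₀ hH0.le hε.le (by omega)).1 hc
    refine ⟨H, H, hH0, le_rfl, by rw [← hHV]; ring, hr, ?_, Or.inl rfl⟩
    rw [hr, div_self (by positivity), one_mul, ← hHV, pow_succ']
    gcongr
  · push Not at hc
    -- With L = V / H^m, the balance ε H^m = (L/H)² V reads ε H^(3m+2) = V³.
    set H := (V ^ 3 / ε) ^ (((3 * m + 2 : ℕ) : ℝ)⁻¹) with hH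
    have hH0 : 0 < H := Real.rpow_pos_of_pos (by positivity) _
    have hHV : H ^ (3 * m + 2) = V ^ 3 / ε := Real.rpow_inv_natCast_pow (by positivity) (by omega)
    have hr : scalingRate (m + 1) ε V = ε * H ^ m := by
      rw [scalingRate, if_neg (not_le.2 hc), hH, ← Real.rpow_mul_natCast (by positivity),
        Real.div_rpow (by positivity) hε.le, ← Real.rpow_natCast V 3, ← Real.rpow_mul hV.le]
      have h0 : ∀ p q : ℝ, ε * (V ^ p / ε ^ q) = ε ^ (1 - q) * V ^ p := fun p q => by
        rw [Real.rpow_sub hε, Real.rpow_one]; ring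
      rw [h0]
      have h1 : (3 * (m : ℝ) + 2) ≠ 0 := by positivity
      have h2 : (3 * ((m : ℝ) + 1) - 1) = 3 * (m : ℝ) + 2 := by ring
      congr 2
      · push_cast
        rw [h2]
        field_simp
        ring
      · push_cast
        rw [h2]
        field_simp
        ring
    have hLH : V / H ^ m ≤ H := by
      rw [div_le_iff₀ (by positivity), ← pow_succ']
      -- Raised to the power 3m+2, the claim V ≤ H^(m+1) reduces to ε^(m+1) ≤ V, the regime at hand.
      refine (pow_le_pow_iff_left₀ hV.le (by positivity) (n := 3 * m + 2) (by omega)).1 ?_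
      rw [← pow_mul, mul_comm (m + 1), pow_mul, hHV, div_pow, le_div_iff₀ (by positivity)]
      calc V ^ (3 * m + 2) * ε ^ (m + 1) ≤ V ^ (3 * m + 2) * V := by gcongr
        _ = _ := by rw [← pow_succ, ← pow_mul, mul_add_one]
    have he : (V / H ^ m) ^ 2 / H ^ 2 * V = scalingRate (m + 1) ε V := by
      have h3 : V ^ 3 = ε * H ^ (3 * m + 2) := by rw [hHV]; field_simp
      rw [hr]
      field_simp
      rw [h3]
      ring
    exact ⟨V / H ^ m, H, by positivity, hLH, by field_simp, hr, he.le, Or.inr he⟩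

/-! ### Entries of the wells and the lower bound -/

lemma firstBasisVector_zero {n : ℕ} (i : Fin n) (hi : (i : ℕ) = 0) (a : ℝ) :
    (a • Matrix.vecMulVec (firstBasisVector n) (firstBasisVector n)) i i = a := by
  simp [Matrix.vecMulVec_apply, firstBasisVector, hi]

/-- The entry of a phase indicator in the direction of the wells determines its support. -/
lemma wells_entry {n : ℕ} {lam : ℝ} (hlam : lam ∈ Set.Ioo (0 : ℝ) 1) {i : Fin n}
    (hi : (i : ℕ) = 0) {M : Mat n} (hM : M ∈ wells n lam ∪ {0}) :
    |M i i| ≤ 1 ∧ (M = 0 → M i i = 0) ∧ (M ≠ 0 → min lam (1 - lam) ≤ |M i i|) := by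
  obtain ⟨h0, h1⟩ := hlam
  rcases hM with (rfl | rfl) | rfl
  · rw [firstBasisVector_zero i hi, abs_neg, abs_of_pos h0]
    exact ⟨h1.le, fun h => by simpa [firstBasisVector_zero i hi] using congrFun₂ h i i,
      fun _ => min_le_left _ _⟩
  · rw [firstBasisVector_zero i hi, abs_of_pos (by linarith)]
    exact ⟨by linarith, fun h => by simpa [firstBasisVector_zero i hi] using congrFun₂ h i i,
      fun _ => min_le_right _ _⟩
  · simp

section Volume

variable {n : ℕ} {lam V : ℝ} {χ : Space n → Mat n} {i : Fin n}

lemma integral_abs_entry_le (hlam : lam ∈ Set.Ioo (0 : ℝ) 1) (hi : (i : ℕ) = 0)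
    (hχ : IsBVInto (wells n lam ∪ {0}) χ) (hV : 0 ≤ V)
    (hvol : volume (Function.support χ) = ENNReal.ofReal V) : ∫ x, |χ x i i| ≤ V := by
  refine (ENNReal.ofReal_le_ofReal_iff hV).1 ?_
  rw [ofReal_integral_eq_lintegral_ofReal (hχ.integrable i i).abs (.of_forall fun _ => abs_nonneg _),
    ← hvol]
  refine le_trans (lintegral_mono_ae ?_) (lintegral_indicator_one_le (Function.support χ))
  filter_upwards [hχ.mem] with x hx
  obtain ⟨h1, h2, -⟩ := wells_entry hlam hi hx
  by_cases h : χ x = 0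
  · simp [h]
  · rw [Set.indicator_of_mem (by exact h)]
    simpa using h1

lemma le_integral_entry_sq (hlam : lam ∈ Set.Ioo (0 : ℝ) 1) (hi : (i : ℕ) = 0)
    (hχ : IsBVInto (wells n lam ∪ {0}) χ) (hχ2 : MemLp (fun x => χ x i i) 2)
    (hvol : volume (Function.support χ) = ENNReal.ofReal V) :
    min lam (1 - lam) ^ 2 * V ≤ ∫ x, χ x i i ^ 2 := by
  have hc : 0 ≤ min lam (1 - lam) := le_min hlam.1.le (by linarith [hlam.2])
  refine (ENNReal.ofReal_le_ofReal_iff (integral_nonneg fun _ => sq_nonneg _)).1 ?_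
  rw [ofReal_integral_eq_lintegral_ofReal hχ2.integrable_sq (.of_forall fun _ => sq_nonneg _),
    ENNReal.ofReal_mul (by positivity), ← hvol]
  refine le_trans ?_ (mul_meas_ge_le_lintegral₀
    hχ2.integrable_sq.1.aemeasurable.ennreal_ofReal
    (ENNReal.ofReal (min lam (1 - lam) ^ 2)))
  gcongr 1
  refine measure_mono_ae ?_
  filter_upwards [hχ.mem] with x hx hx'
  refine ENNReal.ofReal_le_ofReal ?_
  rw [← sq_abs (χ x i i)]
  have := (wells_entry hlam hi hx).2.2 hx'
  gcongr

end Volume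

lemma integral_sq_le_elasticEnergyOf {n : ℕ} {G χ : Space n → Mat n} {E : ℝ} (hE0 : 0 ≤ E)
    (hE : elasticEnergyOf G χ ≤ ENNReal.ofReal E) (i j : Fin n)
    (hm : MemLp (fun x => G x i j - χ x i j) 2) : ∫ x, (G x i j - χ x i j) ^ 2 ≤ E := by
  refine (ENNReal.ofReal_le_ofReal_iff hE0).1 (le_trans ?_ hE)
  rw [ofReal_integral_eq_lintegral_ofReal hm.integrable_sq (.of_forall fun _ => sq_nonneg _)]
  refine lintegral_mono fun x => ENNReal.ofReal_le_ofReal ?_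
  calc _ ≤ ∑ j, (G x i j - χ x i j) ^ 2 :=
        Finset.single_le_sum (f := fun j => (G x i j - χ x i j) ^ 2) (fun j _ => sq_nonneg _)
          (Finset.mem_univ j)
    _ ≤ _ := Finset.single_le_sum (f := fun i => ∑ j, (G x i j - χ x i j) ^ 2)
          (fun i _ => Finset.sum_nonneg fun j _ => sq_nonneg _) (Finset.mem_univ i)

/-- Because these entries vanish, the elastic energy controls the transverse derivatives of u₁
themselves. -/
lemma wells_entry_ne {n : ℕ} {lam : ℝ} {i k : Fin n} (hi : (i : ℕ) = 0) (hk : k ≠ i) {M : Mat n}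
    (hM : M ∈ wells n lam ∪ {0}) : M i k = 0 := by
  have hk0 : (k : ℕ) ≠ 0 := fun h => hk (Fin.ext (h.trans hi.symm))
  rcases hM with (rfl | rfl) | rfl <;> simp [Matrix.vecMulVec_apply, firstBasisVector, hk0]

theorem scalingRate_pos {n : ℕ} {ε V : ℝ} (hε : 0 < ε) (hV : 0 < V) : 0 < scalingRate n ε V := by
  unfold scalingRate
  split_ifs <;> positivity

theorem le_minimalEnergy {n : ℕ} (hn : 2 ≤ n) {lam : ℝ} (hlam : lam ∈ Set.Ioo (0 : ℝ) 1) {κ C : ℝ}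
    (hκ : κ = min lam (1 - lam) ^ 2) (hC : C = (κ / (64 * n)) ^ 2) {ε V : ℝ} (hε : 0 < ε)
    (hV : 0 < V) : ENNReal.ofReal (C * scalingRate n ε V) ≤ minimalEnergy (wells n lam) ε V := by
  have hn0 : (2 : ℝ) ≤ n := by exact_mod_cast hn
  have hmin : 0 < min lam (1 - lam) := lt_min hlam.1 (by linarith [hlam.2])
  have hκ0 : 0 < κ := by rw [hκ]; positivity
  have hκ1 : κ ≤ 1 := by
    rw [hκ]
    exact pow_le_one₀ hmin.le ((min_le_left _ _).trans hlam.2.le)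
  have hsC : √C = κ / (64 * n) := by rw [hC, Real.sqrt_sq (by positivity)]
  have hC0 : 0 < C := by rw [hC]; positivity
  have hr0 := scalingRate_pos (n := n) hε hV
  set i : Fin n := ⟨0, by omega⟩ with hidef
  have hi : (i : ℕ) = 0 := rfl
  refine le_iInf fun χ => le_iInf fun hχ => le_iInf fun hvol => ?_
  by_contra! hlt
  have hel : elasticEnergy χ < ENNReal.ofReal (C * scalingRate n ε V) := le_self_add.trans_lt hlt
  have htv : ENNReal.ofReal ε * totalVariation χ ≤ ENNReal.ofReal (C * scalingRate n ε V) :=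
    le_add_self.trans hlt.le
  simp only [elasticEnergy, iInf_lt_iff] at hel
  obtain ⟨u, G, hu, hE⟩ := hel
  obtain ⟨L, H, hL, hLH, hLV, hr, -, hcase⟩ := exists_scales hn hε hV
  have hH : 0 < H := hL.trans_le hLH
  set P := C * H ^ (n - 1) with hPdef
  have hP : totalVariation χ ≤ ENNReal.ofReal P := by
    have h1 : C * scalingRate n ε V = ε * P := by rw [hr, hPdef]; ring
    rw [h1, ENNReal.ofReal_mul hε.le] at htv
    exact (ENNReal.mul_le_mul_iff_right (by simpa using hε) ENNReal.ofReal_ne_top).1 htv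
  have hP0 : 0 ≤ P := by positivity
  have hχi := hχ.integrable i i
  have hχ1 : ∀ᵐ x, |χ x i i| ≤ 1 := hχ.mem.mono fun x hx => (wells_entry hlam hi hx).1
  have hχ2 : MemLp (fun x => χ x i i) 2 := by
    rw [memLp_two_iff_integrable_sq hχi.1]
    refine (hχi.bdd_mul hχi.1 (c := 1) hχ1).congr (.of_forall fun x => ?_)
    simp [pow_two]
  have hVf := integral_abs_entry_le hlam hi hχ hV.le hvol
  have hf2 := le_integral_entry_sq hlam hi hχ hχ2 hvol
  rw [← hκ] at hf2
  obtain ⟨g, hg, hgV, hfg⟩ := exists_isTest_approx (η := κ * V / 2) hχi hχ1 hVf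
    (lt_of_lt_of_le (by linarith [mul_pos hκ0 hV]) hf2)
  set K := 8 / κ with hK
  have hK8 : 8 ≤ K := by rw [hK, le_div_iff₀ hκ0]; linarith
  have hKV : V / K = κ * V / 8 := by rw [hK]; field_simp
  have hCK : n * (K * C) ≤ κ / 8 := by
    rw [hC, hK]
    field_simp
    nlinarith
  rcases hcase with hcase | hcase
  · subst hcase
    have hLn : L ^ n = V := by
      rw [← hLV, ← pow_succ', Nat.sub_add_cancel (by omega)]
    have h1 := integral_mul_le_isotropic hP0 hP hχi hVf hg hgV (a := K * L) (by positivity)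
    have h2 : V * (V / (K * L) ^ n) ≤ V / K := by
      rw [mul_pow, hLn, ← mul_div_assoc, mul_comm (K ^ n), mul_div_mul_left _ _ hV.ne']
      have : K ≤ K ^ n := le_self_pow₀ (by linarith) (by omega)
      gcongr
    have h3 : n * (K * L * P) ≤ κ / 8 * V := by
      rw [hPdef]
      calc n * (K * L * (C * L ^ (n - 1))) = n * (K * C) * (L * L ^ (n - 1)) := by ring
        _ = n * (K * C) * V := by rw [hLV]
        _ ≤ _ := by gcongr
    linarith [mul_pos hκ0 hV]
  · have hEle := fun i j hm => integral_sq_le_elasticEnergyOf (by positivity) hE.le i j hm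
    have hEi := hEle i i ((hu.memLp_gradient i i).sub hχ2)
    have hEk : ∀ k, k ≠ i → ∫ x, G x i k ^ 2 ≤ C * scalingRate n ε V := by
      intro k hk
      have h0 : ∀ᵐ x, G x i k - χ x i k = G x i k :=
        hχ.mem.mono fun x hx => by rw [wells_entry_ne hi hk hx, sub_zero]
      have := hEle i k ((memLp_congr_ae h0).2 (hu.memLp_gradient i k))
      rwa [integral_congr_ae (g := fun x => G x i k ^ 2) (h0.mono fun x hx => by simp only [hx])]
        at this
    have h1 := integral_mul_le_anisotropic hP0 hP hχi hχ2 hVf hu hEi hEk hg hgV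
      (a := K * L) (b := H) (by positivity) hH
    have h2 : V * (V / (K * L * H ^ (n - 1))) = V / K := by
      rw [mul_assoc, hLV]
      field_simp
    have h3 : K * L * P ≤ κ / 8 * V := by
      rw [hPdef]
      calc K * L * (C * H ^ (n - 1)) = K * C * (L * H ^ (n - 1)) := by ring
        _ = 1 * (K * C) * V := by rw [hLV]; ring
        _ ≤ n * (K * C) * V := by gcongr; linarith
        _ ≤ _ := by gcongr
    -- The balance of scales gives this factor L / H, which cancels the H / L coming from 1 + b / a.
    have h4 : √(C * scalingRate n ε V) * √V = √C * (L / H) * V := by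
      rw [← hcase, Real.sqrt_mul hC0.le, ← div_pow, Real.sqrt_mul (by positivity),
        Real.sqrt_sq (by positivity)]
      linear_combination √C * (L / H) * Real.mul_self_sqrt hV.le
    have h5 : 1 + H / (K * L) ≤ 2 * (H / L) := by
      have : 1 ≤ H / L := (one_le_div hL).2 hLH
      have : H / (K * L) ≤ H / L := by
        gcongr
        exact le_mul_of_one_le_left hL.le (by linarith)
      linarith
    have h6 : n * (2 * (1 + H / (K * L)) * (√(C * scalingRate n ε V) * √V)) ≤ κ / 16 * V := by
      rw [h4, hsC]
      calc n * (2 * (1 + H / (K * L)) * (κ / (64 * n) * (L / H) * V))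
          ≤ n * (2 * (2 * (H / L)) * (κ / (64 * n) * (L / H) * V)) := by gcongr
        _ = _ := by field_simp; norm_num
    linarith [mul_pos hκ0 hV]

/-! ### The divergence of a bounded field on convex sets -/

/-- Up to a null set J is an interval, so the fundamental theorem of calculus leaves two boundary
values. -/
lemma abs_setIntegral_deriv_le_of_ordConnected {J : Set ℝ} (hJ : J.OrdConnected) {D : ℝ}
    (hD : J ⊆ Set.Icc (-D) D) {q q' : ℝ → ℝ} (hq : ∀ r, HasDerivAt q (q' r) r)
    (hq' : Continuous q') (h1 : ∀ r, |q r| ≤ 1) : |∫ r in J, q' r| ≤ 2 := by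
  rcases J.eq_empty_or_nonempty with rfl | hne
  · simp
  have hbb : BddBelow J := bddBelow_Icc.mono hD
  have hba : BddAbove J := bddAbove_Icc.mono hD
  set a := sInf J
  set b := sSup J
  have hab : a ≤ b := csInf_le_csSup hne hbb hba
  have h1J : Set.Ioo a b ⊆ J := by
    intro r hr
    obtain ⟨s, hs, hsr⟩ := exists_lt_of_csInf_lt hne hr.1
    obtain ⟨t, ht, hrt⟩ := exists_lt_of_lt_csSup hne hr.2
    exact hJ.out hs ht ⟨hsr.le, hrt.le⟩
  have hJ2 : J ⊆ Set.Icc a b := fun r hr => ⟨csInf_le hbb hr, le_csSup hba hr⟩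
  have hae : J =ᵐ[volume] Set.Ioc a b :=
    (hJ2.eventuallyLE.trans_eq Ioc_ae_eq_Icc.symm).antisymm
      (Ioo_ae_eq_Ioc.symm.trans_le h1J.eventuallyLE)
  rw [setIntegral_congr_set hae, ← intervalIntegral.integral_of_le hab,
    intervalIntegral.integral_eq_sub_of_hasDerivAt (fun r _ => hq r) (hq'.intervalIntegrable a b)]
  calc |q b - q a| ≤ |q b| + |q a| := abs_sub _ _
    _ ≤ 2 := by linarith [h1 a, h1 b]

/-- Fubini along direction k: each line meets S in an interval and contributes at most 2, and the
lines that meet S project into a cube of measure (2D)^m. This serves as a perimeter bound for convex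
sets. -/
lemma abs_setIntegral_partialDeriv_le {m : ℕ} {S : Set (Space (m + 1))} (hS : Convex ℝ S)
    (hSm : MeasurableSet S) {D : ℝ} (hD0 : 0 ≤ D) (hD : ∀ x ∈ S, ∀ k, |x k| ≤ D) (k : Fin (m + 1))
    {ψ : Space (m + 1) → ℝ} (hψ : ContDiff ℝ 1 ψ) (hs : HasCompactSupport ψ)
    (h1 : ∀ x, |ψ x| ≤ 1) : |∫ x in S, partialDeriv k ψ x| ≤ 2 * (2 * D) ^ m := by
  have hcont : Continuous (partialDeriv k ψ) :=
    (hψ.continuous_fderiv one_ne_zero).clm_apply continuous_const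
  set F : Space (m + 1) → ℝ := S.indicator (partialDeriv k ψ) with hF
  have hFi : Integrable F :=
    (hcont.integrable_of_hasCompactSupport (hasCompactSupport_partialDeriv hs k)).indicator hSm
  set e := (MeasurableEquiv.piFinSuccAbove (fun _ : Fin (m + 1) => ℝ) k).symm with he
  have hmp : MeasurePreserving (fun z : ℝ × (Fin m → ℝ) => (WithLp.toLp 2 (e z) : Space (m + 1)))
      (volume.prod volume) volume :=
    (PiLp.volume_preserving_toLp (Fin (m + 1))).comp
      (volume_preserving_piFinSuccAbove (fun _ : Fin (m + 1) => ℝ) k).symm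
  have hemb : MeasurableEmbedding
      (fun z : ℝ × (Fin m → ℝ) => (WithLp.toLp 2 (e z) : Space (m + 1))) :=
    (MeasurableEquiv.toLp 2 (Fin (m + 1) → ℝ)).measurableEmbedding.comp e.measurableEmbedding
  have hp : ∀ (r : ℝ) (y : Fin m → ℝ), (WithLp.toLp 2 (e (r, y)) : Space (m + 1))
      = WithLp.toLp 2 (e (0, y)) + r • EuclideanSpace.single k 1 := by
    intro r y
    ext j
    refine Fin.succAboveCases k ?_ (fun j => ?_) j
    · simp [he, MeasurableEquiv.piFinSuccAbove, Fin.insertNthEquiv]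
    · simp [he, MeasurableEquiv.piFinSuccAbove, Fin.insertNthEquiv, Fin.succAbove_ne]
  have hek : ∀ (r : ℝ) (y : Fin m → ℝ), (WithLp.toLp 2 (e (r, y)) : Space (m + 1)) k = r := by
    intro r y
    simp [he, MeasurableEquiv.piFinSuccAbove, Fin.insertNthEquiv]
  have hej : ∀ (r : ℝ) (y : Fin m → ℝ) (j : Fin m),
      (WithLp.toLp 2 (e (r, y)) : Space (m + 1)) (k.succAbove j) = y j := by
    intro r y j
    simp [he, MeasurableEquiv.piFinSuccAbove, Fin.insertNthEquiv]
  have hFe : Integrable (fun z : ℝ × (Fin m → ℝ) => F (WithLp.toLp 2 (e z)))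
      (volume.prod volume) := (hmp.integrable_comp_emb hemb).2 hFi
  rw [← integral_indicator hSm, ← hF, ← hmp.integral_comp hemb, integral_prod_symm _ hFe]
  set Q : Set (Fin m → ℝ) := Set.Icc (fun _ => -D) (fun _ => D) with hQ
  have hQv : volume.real Q = (2 * D) ^ m := by
    rw [hQ, Measure.real, Real.volume_Icc_pi_toReal (fun _ => by linarith)]
    simp [two_mul]
  have hQf : volume Q ≠ ⊤ := isCompact_Icc.measure_ne_top
  have hinner : ∀ y : Fin m → ℝ, ‖∫ r, F (WithLp.toLp 2 (e (r, y)))‖ ≤ Q.indicator (fun _ => 2) y := by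
    intro y
    set p : ℝ → Space (m + 1) := fun r => WithLp.toLp 2 (e (r, y)) with hpdef
    have hpr : ∀ r, p r = p 0 + r • EuclideanSpace.single k 1 := fun r => hp r y
    by_cases hy : y ∈ Q
    · rw [Set.indicator_of_mem hy]
      set J : Set ℝ := p ⁻¹' S with hJ
      have hpc : Continuous p := by
        rw [funext hpr]
        fun_prop
      have hJm : MeasurableSet J := hpc.measurable hSm
      have hJo : J.OrdConnected := by
        refine Convex.ordConnected ?_
        intro r hr s hs a b ha hb hab
        have : p (a • r + b • s) = a • p r + b • p s := by
          rw [hpr r, hpr s, hpr]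
          have : p 0 = (a + b) • p 0 := by rw [hab, one_smul]
          nth_rewrite 1 [this]
          simp only [smul_eq_mul]
          module
        change p (a • r + b • s) ∈ S
        rw [this]
        exact hS hr hs ha hb hab
      have hJD : J ⊆ Set.Icc (-D) D := by
        intro r hr
        have := hD _ hr k
        rw [hek] at this
        exact abs_le.1 this
      have hder : ∀ r, HasDerivAt (fun r => ψ (p r)) (partialDeriv k ψ (p r)) r := by
        intro r
        have hd : HasDerivAt p (EuclideanSpace.single k 1) r := by
          rw [funext hpr]
          simpa using ((hasDerivAt_id r).smul_const (EuclideanSpace.single k (1 : ℝ))).const_add (p 0)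
        exact ((hψ.differentiable one_ne_zero).differentiableAt (x := p r)).hasFDerivAt.comp_hasDerivAt
          r hd
      have hFJ : ∀ r, F (p r) = J.indicator (fun r => partialDeriv k ψ (p r)) r := fun r => rfl
      change ‖∫ r, F (p r)‖ ≤ 2
      simp_rw [hFJ]
      rw [integral_indicator hJm]
      exact abs_setIntegral_deriv_le_of_ordConnected hJo hJD hder (hcont.comp hpc) fun r => h1 _
    · rw [Set.indicator_of_notMem hy]
      have : ∀ r, F (p r) = 0 := by
        intro r
        refine Set.indicator_of_notMem (fun hr => hy ?_) _
        have hj : ∀ j, |y j| ≤ D := fun j => by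
          have := hD _ hr (k.succAbove j)
          rwa [hej] at this
        exact ⟨fun j => (abs_le.1 (hj j)).1, fun j => (abs_le.1 (hj j)).2⟩
      change ‖∫ r, F (p r)‖ ≤ 0
      simp [this]
  have hQi : Integrable (Q.indicator fun _ => (2 : ℝ)) :=
    (integrable_indicator_iff measurableSet_Icc).2 (integrableOn_const hQf)
  refine (norm_integral_le_of_norm_le hQi (.of_forall hinner)).trans_eq ?_
  rw [integral_indicator measurableSet_Icc, setIntegral_const, hQv, smul_eq_mul, mul_comm]

/-! ### The inclusion -/

section Inclusion

variable {n : ℕ} (i : Fin n) (lam L H : ℝ)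

/-- The part of the gauge of the inclusion that does not depend on the coordinate `x i`. -/
def crossGauge (x : Space n) : ℝ := ∑ k ∈ Finset.univ.erase i, |x k / H|

/-- The gauge of a bipyramid of width `L` in the direction `i` and of height `2 H` in the others. -/
def gauge (x : Space n) : ℝ :=
  max (-(x i / (lam * L))) (x i / ((1 - lam) * L)) + crossGauge i H x

/-- The bipyramid `{gauge < 1}`. -/
def bipyramid : Set (Space n) := {x | gauge i lam L H x < 1}

/-- The tent function over the bipyramid. -/
def tent (x : Space n) : ℝ := lam * (1 - lam) * L * max 0 (1 - gauge i lam L H x)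

variable {i lam L H}

lemma crossGauge_nonneg (x : Space n) : 0 ≤ crossGauge i H x :=
  Finset.sum_nonneg fun _ _ => abs_nonneg _

lemma continuous_gauge : Continuous (gauge i lam L H) := by
  unfold gauge crossGauge
  fun_prop

lemma isOpen_bipyramid : IsOpen (bipyramid i lam L H) :=
  isOpen_lt continuous_gauge continuous_const

lemma convexOn_gauge : ConvexOn ℝ Set.univ (gauge i lam L H) := by
  have hlin : ∀ (k : Fin n) (c : ℝ), ConvexOn ℝ Set.univ fun x : Space n => x k * c := by
    intro k c
    refine ⟨convex_univ, fun x _ y _ a b _ _ _ => le_of_eq ?_⟩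
    simp only [PiLp.add_apply, PiLp.smul_apply, smul_eq_mul]
    ring
  have h1 : ConvexOn ℝ Set.univ fun x : Space n =>
      max (-(x i / (lam * L))) (x i / ((1 - lam) * L)) := by
    refine ConvexOn.sup (f := fun x : Space n => -(x i / (lam * L))) ?_ ?_
    · simpa only [mul_neg, div_eq_mul_inv] using hlin i (-(lam * L)⁻¹)
    · simpa only [div_eq_mul_inv] using hlin i ((1 - lam) * L)⁻¹
  refine h1.add ?_
  refine ⟨convex_univ, fun x _ y _ a b ha hb _ => ?_⟩
  simp only [crossGauge, smul_eq_mul, Finset.mul_sum, ← Finset.sum_add_distrib]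
  refine Finset.sum_le_sum fun k _ => ?_
  calc |(a • x + b • y) k / H| = |a * (x k / H) + b * (y k / H)| := by
        simp only [PiLp.add_apply, PiLp.smul_apply, smul_eq_mul]; congr 1; ring
    _ ≤ |a * (x k / H)| + |b * (y k / H)| := abs_add_le _ _
    _ = _ := by rw [abs_mul, abs_mul, abs_of_nonneg ha, abs_of_nonneg hb]

lemma convex_bipyramid : Convex ℝ (bipyramid i lam L H) := by
  simpa [bipyramid] using convexOn_gauge.convex_lt (1 : ℝ)

lemma abs_le_of_mem_bipyramid (hlam : lam ∈ Set.Ioo (0 : ℝ) 1) (hL : 0 < L) (hH : 0 < H) {D : ℝ}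
    (hLD : L ≤ D) (hHD : H ≤ D) {x : Space n} (hx : x ∈ bipyramid i lam L H) (k : Fin n) :
    |x k| ≤ D := by
  obtain ⟨h0, h1⟩ := hlam
  have h1' : 0 < 1 - lam := by linarith
  have hx' : gauge i lam L H x < 1 := hx
  by_cases hk : k = i
  · subst hk
    have hm : max (-(x k / (lam * L))) (x k / ((1 - lam) * L)) < 1 := by
      have := crossGauge_nonneg (i := k) (H := H) x
      unfold gauge at hx'
      linarith
    obtain ⟨ha, hb⟩ := max_lt_iff.1 hm
    rw [← neg_div, div_lt_one (by positivity)] at ha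
    rw [div_lt_one (by positivity)] at hb
    rw [abs_le]
    constructor <;> nlinarith
  · have hm : 0 ≤ max (-(x i / (lam * L))) (x i / ((1 - lam) * L)) := by
      rcases le_total 0 (x i) with h | h
      · exact le_max_of_le_right (by positivity)
      · refine le_max_of_le_left ?_
        rw [← neg_div]
        exact div_nonneg (by linarith) (by positivity)
    have hs : |x k / H| ≤ crossGauge i H x :=
      Finset.single_le_sum (f := fun k => |x k / H|) (fun _ _ => abs_nonneg _)
        (Finset.mem_erase.2 ⟨hk, Finset.mem_univ k⟩)
    have : |x k / H| < 1 := by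
      unfold gauge at hx'
      linarith
    rw [abs_div, abs_of_pos hH, div_lt_one hH] at this
    linarith

lemma isBounded_bipyramid (hlam : lam ∈ Set.Ioo (0 : ℝ) 1) (hL : 0 < L) (hH : 0 < H) :
    Bornology.IsBounded (bipyramid i lam L H) := by
  refine (PiLp.antilipschitzWith_ofLp 2 (fun _ : Fin n => ℝ)).isBounded_preimage
    (Metric.isBounded_Icc (fun _ => -max L H) (fun _ => max L H)) |>.subset fun x hx => ?_
  have := abs_le_of_mem_bipyramid hlam hL hH (le_max_left L H) (le_max_right L H) hx
  exact ⟨fun k => (abs_le.1 (this k)).1, fun k => (abs_le.1 (this k)).2⟩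

/-- The volume of the bipyramid is proportional to `L H ^ (n - 1)`. -/
lemma volume_bipyramid (hL : 0 < L) (hH : 0 < H) :
    volume (bipyramid i lam L H)
      = ENNReal.ofReal (L * H ^ (n - 1)) * volume (bipyramid i lam 1 1) := by
  -- This diagonal rescaling maps the bipyramid onto the unit one.
  set d : Fin n → ℝ := fun k => if k = i then L⁻¹ else H⁻¹ with hd
  have hdet : LinearMap.det (Matrix.toLin' (Matrix.diagonal d)) = (L * H ^ (n - 1))⁻¹ := by
    rw [LinearMap.det_toLin', Matrix.det_diagonal, ← Finset.mul_prod_erase _ _ (Finset.mem_univ i),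
      Finset.prod_congr rfl (g := fun _ => H⁻¹)
        (fun k hk => if_neg (Finset.ne_of_mem_erase hk))]
    simp [hd, mul_comm]
  have hpos : 0 < L * H ^ (n - 1) := by positivity
  have hpre : (WithLp.toLp 2 : (Fin n → ℝ) → Space n) ⁻¹' bipyramid i lam L H
      = Matrix.toLin' (Matrix.diagonal d) ⁻¹'
        ((WithLp.toLp 2 : (Fin n → ℝ) → Space n) ⁻¹' bipyramid i lam 1 1) := by
    ext x
    have hc : crossGauge i H (WithLp.toLp 2 x)
        = crossGauge i 1 (WithLp.toLp 2 (Matrix.toLin' (Matrix.diagonal d) x)) := by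
      refine Finset.sum_congr rfl fun k hk => ?_
      simp [Matrix.mulVec_diagonal, hd, Finset.ne_of_mem_erase hk, div_eq_inv_mul]
    have hx : Matrix.toLin' (Matrix.diagonal d) x i = L⁻¹ * x i := by
      simp [Matrix.mulVec_diagonal, hd]
    have hs : ∀ c : ℝ, x i / (c * L) = L⁻¹ * x i / (c * 1) := fun c => by
      simp only [div_eq_mul_inv, mul_inv, mul_one]; ring
    simp only [bipyramid, gauge, Set.mem_preimage, Set.mem_ofPred_eq, hc, hx, hs]
  have hv : ∀ L H : ℝ, volume (bipyramid i lam L H)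
      = volume ((WithLp.toLp 2 : (Fin n → ℝ) → Space n) ⁻¹' bipyramid i lam L H) := fun L H =>
    ((PiLp.volume_preserving_toLp (Fin n)).measure_preimage
      isOpen_bipyramid.measurableSet.nullMeasurableSet).symm
  rw [hv, hv, hpre, Measure.addHaar_preimage_linearMap _ (by rw [hdet]; positivity), hdet, inv_inv,
    abs_of_pos hpos]

lemma volume_unit_bipyramid (hlam : lam ∈ Set.Ioo (0 : ℝ) 1) :
    0 < volume (bipyramid i lam 1 1) ∧ volume (bipyramid i lam 1 1) < ⊤ := by
  refine ⟨isOpen_bipyramid.measure_pos _ ⟨0, ?_⟩,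
    (isBounded_bipyramid hlam one_pos one_pos).measure_lt_top⟩
  simp [bipyramid, gauge, crossGauge]

lemma exists_lipschitzWith_tent : ∃ C, LipschitzWith C (tent i lam L H) := by
  have hcoord : ∀ (k : Fin n) (c : ℝ), ∃ C, LipschitzWith C fun x : Space n => c * x k :=
    fun k c => ⟨_, (c • EuclideanSpace.proj (𝕜 := ℝ) k : Space n →L[ℝ] ℝ).lipschitz⟩
  have hsum : ∀ s : Finset (Fin n), ∃ C, LipschitzWith C fun x : Space n => ∑ k ∈ s, |x k / H| := by
    intro s
    induction s using Finset.induction_on with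
    | empty => exact ⟨0, by simp⟩
    | insert k s hk ih =>
      obtain ⟨C, hC⟩ := ih
      obtain ⟨C', hC'⟩ := hcoord k H⁻¹
      refine ⟨1 * C' + C, ?_⟩
      simp_rw [Finset.sum_insert hk, div_eq_inv_mul] at hC ⊢
      exact (lipschitzWith_one_norm.comp hC').add hC
  obtain ⟨C₁, h₁⟩ := hcoord i (-(lam * L)⁻¹)
  obtain ⟨C₂, h₂⟩ := hcoord i ((1 - lam) * L)⁻¹
  obtain ⟨C₃, h₃⟩ := hsum (Finset.univ.erase i)
  have hg : ∃ C, LipschitzWith C (gauge i lam L H) := by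
    refine ⟨max C₁ C₂ + C₃, ?_⟩
    have : gauge i lam L H = fun x => max (-(lam * L)⁻¹ * x i) (((1 - lam) * L)⁻¹ * x i)
        + ∑ k ∈ Finset.univ.erase i, |x k / H| := by
      funext x
      simp only [gauge, crossGauge, div_eq_inv_mul, neg_mul]
    rw [this]
    exact (h₁.max h₂).add h₃
  obtain ⟨C, hC⟩ := hg
  have h1 : LipschitzWith C fun x => 1 - gauge i lam L H x := by
    simpa using (LipschitzWith.const (1 : ℝ)).sub hC
  exact ⟨_, (lipschitzWith_smul (lam * (1 - lam) * L)).comp (h1.const_max 0)⟩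

end Inclusion

/-! ### Displacement, phases and energy of the inclusion -/

section Energy

variable {n : ℕ} {i : Fin n} {lam L H : ℝ}

lemma tent_eq_zero {x : Space n} (hx : x ∉ bipyramid i lam L H) : tent i lam L H x = 0 := by
  have : 1 ≤ gauge i lam L H x := not_lt.1 hx
  rw [tent, max_eq_left (by linarith), mul_zero]

lemma tent_of_mem {x : Space n} (hx : x ∈ bipyramid i lam L H) :
    tent i lam L H x = lam * (1 - lam) * L * (1 - gauge i lam L H x) := by
  have : gauge i lam L H x < 1 := hx
  rw [tent, max_eq_right (by linarith)]

lemma hasCompactSupport_tent (hlam : lam ∈ Set.Ioo (0 : ℝ) 1) (hL : 0 < L) (hH : 0 < H) :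
    HasCompactSupport (tent i lam L H) :=
  HasCompactSupport.intro (isBounded_bipyramid hlam hL hH).isCompact_closure fun _ hx =>
    tent_eq_zero fun h => hx (subset_closure h)

lemma lineDeriv_tent_eq_zero {x : Space n} (hx : x ∉ closure (bipyramid i lam L H)) (v : Space n) :
    lineDeriv ℝ (tent i lam L H) x v = 0 := by
  have : tent i lam L H =ᶠ[nhds x] fun _ => 0 := by
    filter_upwards [isClosed_closure.isOpen_compl.mem_nhds hx] with y hy
    exact tent_eq_zero fun h => hy (subset_closure h)
  rw [this.lineDeriv_eq]
  simp [lineDeriv]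

lemma crossGauge_add_single (x : Space n) (t : ℝ) :
    crossGauge i H (x + t • EuclideanSpace.single i 1) = crossGauge i H x := by
  refine Finset.sum_congr rfl fun k hk => ?_
  simp [Finset.ne_of_mem_erase hk]

lemma eventually_add_single_mem (x : Space n) {U : Set (Space n)} (hU : IsOpen U) (hx : x ∈ U)
    (k : Fin n) : ∀ᶠ t : ℝ in nhds 0, x + t • EuclideanSpace.single k 1 ∈ U := by
  have hc : Continuous fun t : ℝ => x + t • (EuclideanSpace.single k 1 : Space n) := by fun_prop
  exact hc.continuousAt.preimage_mem_nhds (by simpa using hU.mem_nhds hx)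

lemma isOpen_coord_lt (k : Fin n) (c : ℝ) : IsOpen {x : Space n | x k < c} :=
  isOpen_lt (by fun_prop) continuous_const

lemma isOpen_lt_coord (k : Fin n) (c : ℝ) : IsOpen {x : Space n | c < x k} :=
  isOpen_lt continuous_const (by fun_prop)

/-- On this half the gauge has axial slope -1/(λL), and the prefactor λ(1-λ)L of the tent turns it
into exactly the value of a well. -/
lemma lineDeriv_tent_of_neg (hlam : lam ∈ Set.Ioo (0 : ℝ) 1) (hL : 0 < L) {x : Space n}
    (hx : x ∈ bipyramid i lam L H) (hi : x i < 0) :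
    lineDeriv ℝ (tent i lam L H) x (EuclideanSpace.single i 1) = 1 - lam := by
  obtain ⟨h0, h1⟩ := hlam
  have h1' : 0 < 1 - lam := by linarith
  refine HasLineDerivAt.lineDeriv (HasDerivAt.congr_of_eventuallyEq
    (f := fun t : ℝ => lam * (1 - lam) * L * (1 - (-((x i + t) / (lam * L)) + crossGauge i H x)))
    ?_ ?_)
  · have := (((((hasDerivAt_id (0 : ℝ)).const_add (x i)).div_const (lam * L)).neg.add_const
      (crossGauge i H x)).const_sub 1).const_mul (lam * (1 - lam) * L)
    refine this.congr_deriv ?_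
    field_simp
  · filter_upwards [eventually_add_single_mem x isOpen_bipyramid hx i,
      eventually_add_single_mem x (isOpen_coord_lt i 0) hi i] with t ht ht'
    have hc : (x + t • (EuclideanSpace.single i 1 : Space n)) i = x i + t := by simp
    have hneg : x i + t < 0 := hc ▸ ht'
    rw [tent_of_mem ht, gauge, crossGauge_add_single, hc, max_eq_left]
    rw [← neg_div]
    exact (div_nonpos_of_nonpos_of_nonneg hneg.le (by positivity)).trans
      (div_nonneg (by linarith) (by positivity))

lemma lineDeriv_tent_of_pos (hlam : lam ∈ Set.Ioo (0 : ℝ) 1) (hL : 0 < L) {x : Space n}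
    (hx : x ∈ bipyramid i lam L H) (hi : 0 < x i) :
    lineDeriv ℝ (tent i lam L H) x (EuclideanSpace.single i 1) = -lam := by
  obtain ⟨h0, h1⟩ := hlam
  have h1' : 0 < 1 - lam := by linarith
  refine HasLineDerivAt.lineDeriv (HasDerivAt.congr_of_eventuallyEq
    (f := fun t : ℝ => lam * (1 - lam) * L * (1 - ((x i + t) / ((1 - lam) * L) + crossGauge i H x)))
    ?_ ?_)
  · have := (((((hasDerivAt_id (0 : ℝ)).const_add (x i)).div_const ((1 - lam) * L)).add_const
      (crossGauge i H x)).const_sub 1).const_mul (lam * (1 - lam) * L)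
    refine this.congr_deriv ?_
    field_simp
  · filter_upwards [eventually_add_single_mem x isOpen_bipyramid hx i,
      eventually_add_single_mem x (isOpen_lt_coord i 0) hi i] with t ht ht'
    have hc : (x + t • (EuclideanSpace.single i 1 : Space n)) i = x i + t := by simp
    have hpos : 0 < x i + t := hc ▸ ht'
    rw [tent_of_mem ht, gauge, crossGauge_add_single, hc, max_eq_right]
    rw [← neg_div]
    exact (div_nonpos_of_nonpos_of_nonneg (by linarith) (by positivity)).trans
      (div_nonneg hpos.le (by positivity))

/-- A Lipschitz bound along the line suffices, so the kinks of |x k / H| and of the positive part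
need no separate treatment. -/
lemma abs_lineDeriv_tent_le (hlam : lam ∈ Set.Ioo (0 : ℝ) 1) (hL : 0 < L) (hH : 0 < H) {k : Fin n}
    (hk : k ≠ i) (x : Space n) :
    |lineDeriv ℝ (tent i lam L H) x (EuclideanSpace.single k 1)| ≤ L / H := by
  obtain ⟨h0, h1⟩ := hlam
  have h1' : 0 < 1 - lam := by linarith
  refine norm_deriv_le_of_lip' (𝕜 := ℝ)
    (f := fun t : ℝ => tent i lam L H (x + t • EuclideanSpace.single k 1)) (by positivity) (.of_forall fun t => ?_)
  simp only [zero_smul, add_zero, sub_zero, tent, ← mul_sub, Real.norm_eq_abs, abs_mul]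
  have hcoef : |lam| * |1 - lam| * |L| ≤ L := by
    rw [abs_of_pos h0, abs_of_pos h1', abs_of_pos hL]
    exact mul_le_of_le_one_left hL.le (by nlinarith)
  have hmax : ∀ a b : ℝ, |max 0 (1 - a) - max 0 (1 - b)| ≤ |a - b| := fun a b => by
    rw [max_comm 0, max_comm 0]
    refine (abs_max_sub_max_le_abs _ _ _).trans_eq ?_
    rw [sub_sub_sub_cancel_left, abs_sub_comm]
  set y := x + t • (EuclideanSpace.single k 1 : Space n) with hy
  have hcoord : ∀ j, j ≠ k → y j = x j := fun j hj => by simp [hy, hj]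
  have hg : |gauge i lam L H y - gauge i lam L H x| ≤ |t| / H := by
    have hke : k ∈ Finset.univ.erase i := Finset.mem_erase.2 ⟨hk, Finset.mem_univ k⟩
    have : gauge i lam L H y - gauge i lam L H x = |y k / H| - |x k / H| := by
      have hsum : ∑ j ∈ (Finset.univ.erase i).erase k, |y j / H|
          = ∑ j ∈ (Finset.univ.erase i).erase k, |x j / H| :=
        Finset.sum_congr rfl fun j hj => by rw [hcoord j (Finset.ne_of_mem_erase hj)]
      rw [gauge, gauge, hcoord i hk.symm, crossGauge, crossGauge, ← Finset.add_sum_erase _ _ hke,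
        ← Finset.add_sum_erase _ (fun j => |x j / H|) hke, hsum]
      ring
    rw [this]
    refine (abs_abs_sub_abs_le_abs_sub _ _).trans_eq ?_
    rw [← sub_div, abs_div, abs_of_pos hH]
    congr 2
    simp [hy]
  calc _ ≤ L * (|t| / H) := by
        gcongr
        exact (hmax _ _).trans hg
    _ = _ := by ring

variable (i lam L H) in
/-- The displacement `e₁`-directed with amplitude `tent`. -/
def displacement (x : Space n) : Space n := EuclideanSpace.single i (tent i lam L H x)

variable (i lam L H) in
/-- The weak gradient of `displacement`. -/
def displacementGradient (x : Space n) : Mat n := fun a b =>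
  if a = i then lineDeriv ℝ (tent i lam L H) x (EuclideanSpace.single b 1) else 0

lemma continuous_tent : Continuous (tent i lam L H) := by
  have := continuous_gauge (i := i) (lam := lam) (L := L) (H := H)
  unfold tent
  fun_prop

/-- The tent is Lipschitz with compact support, so its line derivatives are bounded, vanish off a
compact set and satisfy integration by parts. -/
lemma isH1WithGradient_displacement (hlam : lam ∈ Set.Ioo (0 : ℝ) 1) (hL : 0 < L) (hH : 0 < H) :
    IsH1WithGradient (displacement i lam L H) (displacementGradient i lam L H) := by
  have hcs := hasCompactSupport_tent (i := i) hlam hL hH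
  obtain ⟨C, hC⟩ := exists_lipschitzWith_tent (i := i) (lam := lam) (L := L) (H := H)
  refine ⟨?_, fun a b => ?_, fun φ hφ hφs a b => ?_⟩
  · have hs : displacement i lam L H = fun x => tent i lam L H x • EuclideanSpace.single i 1 := by
      funext x
      ext j
      simp [displacement]
    refine Continuous.memLp_of_hasCompactSupport ?_ (hcs.comp_left (g := fun t : ℝ =>
      (EuclideanSpace.single i t : Space n)) (by simp))
    rw [hs]
    exact continuous_tent.smul continuous_const
  · by_cases ha : a = i
    · simp only [displacementGradient, ha, if_true]
      set T := closure (bipyramid i lam L H)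
      have hT : volume T ≠ ⊤ := (isBounded_bipyramid hlam hL hH).isCompact_closure.measure_ne_top
      have hind : (fun x => lineDeriv ℝ (tent i lam L H) x (EuclideanSpace.single b 1))
          = T.indicator fun x => lineDeriv ℝ (tent i lam L H) x (EuclideanSpace.single b 1) := by
        funext x
        by_cases hx : x ∈ T
        · simp [hx]
        · rw [Set.indicator_of_notMem hx, lineDeriv_tent_eq_zero hx]
      rw [hind, memLp_indicator_iff_restrict isClosed_closure.measurableSet]
      have : IsFiniteMeasure (volume.restrict T) := isFiniteMeasure_restrict.2 hT
      exact MemLp.of_bound (measurable_lineDeriv continuous_tent).aestronglyMeasurable _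
        (.of_forall fun x => norm_lineDeriv_le_of_lipschitz ℝ hC)
    · simp [displacementGradient, ha]
  · by_cases ha : a = i
    · subst ha
      simp only [displacement, displacementGradient, if_true]
      obtain ⟨D, hD⟩ : ∃ D, LipschitzWith D φ :=
        hφ.lipschitzWith_of_hasCompactSupport hφs (by simp)
      rw [LipschitzWith.integral_lineDeriv_mul_eq hC hD hφs, ← integral_neg]
      refine integral_congr_ae (.of_forall fun x => ?_)
      have hd : DifferentiableAt ℝ φ x := (hφ.differentiable (by simp)).differentiableAt
      simp [hd.lineDeriv_eq_fderiv, partialDeriv, mul_comm]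
    · simp [displacement, displacementGradient, ha]

variable (i lam L H) in
/-- The phase indicator with the two wells on the two halves of the bipyramid. -/
def phase (x : Space n) : Mat n :=
  (bipyramid i lam L H).indicator (fun x => (if x i < 0 then 1 - lam else -lam) •
    Matrix.vecMulVec (firstBasisVector n) (firstBasisVector n)) x

lemma phase_mem (x : Space n) : phase i lam L H x ∈ wells n lam ∪ {0} := by
  unfold phase
  by_cases hx : x ∈ bipyramid i lam L H
  · rw [Set.indicator_of_mem hx]
    split_ifs
    · exact Or.inl (Or.inr rfl)
    · exact Or.inl (Or.inl rfl)
  · rw [Set.indicator_of_notMem hx]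
    exact Or.inr rfl

lemma phase_apply (hi : (i : ℕ) = 0) (x : Space n) (a b : Fin n) :
    phase i lam L H x a b = if a = i ∧ b = i then
      (bipyramid i lam L H).indicator (fun x => if x i < 0 then 1 - lam else -lam) x else 0 := by
  have hab : ∀ a : Fin n, firstBasisVector n a = if a = i then 1 else 0 := fun a => by
    simp [firstBasisVector, Fin.ext_iff, hi]
  unfold phase
  by_cases hx : x ∈ bipyramid i lam L H
  · simp only [Set.indicator_of_mem hx, Matrix.smul_apply, Matrix.vecMulVec_apply, hab]
    by_cases ha : a = i <;> by_cases hb : b = i <;> simp [ha, hb]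
  · simp [Set.indicator_of_notMem hx]

lemma support_phase (hlam : lam ∈ Set.Ioo (0 : ℝ) 1) (hi : (i : ℕ) = 0) :
    Function.support (phase i lam L H) = bipyramid i lam L H := by
  ext x
  constructor
  · intro hx
    by_contra h
    exact hx (Set.indicator_of_notMem h _)
  · intro hx h
    have := congrFun₂ h i i
    rw [phase_apply hi, if_pos ⟨rfl, rfl⟩, Set.indicator_of_mem hx] at this
    have h1 := hlam.1
    have h2 := hlam.2
    split_ifs at this <;> simp at this <;> linarith

lemma integrable_phase (hlam : lam ∈ Set.Ioo (0 : ℝ) 1) (hL : 0 < L) (hH : 0 < H)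
    (hi : (i : ℕ) = 0) (a b : Fin n) : Integrable fun x => phase i lam L H x a b := by
  simp_rw [phase_apply hi]
  by_cases h : a = i ∧ b = i
  · simp only [h, and_self, if_true]
    rw [integrable_indicator_iff isOpen_bipyramid.measurableSet]
    refine Measure.integrableOn_of_bounded (M := 1)
      (isBounded_bipyramid hlam hL hH).measure_lt_top.ne ?_ (.of_forall fun x => ?_)
    · exact (Measurable.ite (isOpen_coord_lt i 0).measurableSet measurable_const
        measurable_const).aestronglyMeasurable
    · have h1 := hlam.1
      have h2 := hlam.2
      rw [Real.norm_eq_abs, abs_le]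
      split_ifs <;> constructor <;> linarith
  · simp [h]

/-- Almost everywhere the axial derivative matches the phase exactly, and each transverse one
contributes at most (L/H)² inside the bipyramid. -/
lemma elasticEnergy_phase_le (hlam : lam ∈ Set.Ioo (0 : ℝ) 1) (hL : 0 < L) (hH : 0 < H)
    (hi : (i : ℕ) = 0) : elasticEnergy (phase i lam L H)
      ≤ ENNReal.ofReal (n * (L / H) ^ 2) * volume (bipyramid i lam L H) := by
  refine (iInf₂_le_of_le _ _ (iInf_le_of_le (isH1WithGradient_displacement (i := i) hlam hL hH)
    le_rfl)).trans ?_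
  rw [← setLIntegral_const, ← lintegral_indicator isOpen_bipyramid.measurableSet]
  refine lintegral_mono_ae ?_
  -- The kinks on the boundary and on the hyperplane x i = 0 lie in frontiers of convex sets, which
  -- are null.
  have hnull : ∀ᵐ x : Space n, x ∉ frontier (bipyramid i lam L H) :=
    measure_eq_zero_iff_ae_notMem.1 (convex_bipyramid.addHaar_frontier _)
  have hnull' : ∀ᵐ x : Space n, x ∉ frontier {x : Space n | x i < 0} :=
    measure_eq_zero_iff_ae_notMem.1 (Convex.addHaar_frontier _
      (convex_halfSpace_lt (EuclideanSpace.proj (𝕜 := ℝ) i : Space n →L[ℝ] ℝ).isLinear 0))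
  filter_upwards [hnull, hnull'] with x hx hx'
  have hrow : ∀ a b, a ≠ i → displacementGradient i lam L H x a b - phase i lam L H x a b = 0 :=
    fun a b ha => by rw [phase_apply hi]; simp [displacementGradient, ha]
  rw [Finset.sum_eq_single i (fun a _ ha => Finset.sum_eq_zero fun b _ => by
    rw [hrow a b ha]; ring) (by simp)]
  by_cases hxT : x ∈ bipyramid i lam L H
  · rw [Set.indicator_of_mem hxT]
    refine ENNReal.ofReal_le_ofReal ?_
    have hb : ∀ b ∈ Finset.univ,
        (displacementGradient i lam L H x i b - phase i lam L H x i b) ^ 2 ≤ (L / H) ^ 2 := by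
      intro b _
      rw [phase_apply hi]
      by_cases hb : b = i
      · subst hb
        simp only [displacementGradient, and_self, if_true, Set.indicator_of_mem hxT]
        by_cases hneg : x b < 0
        · rw [if_pos hneg, lineDeriv_tent_of_neg hlam hL hxT hneg, sub_self, zero_pow two_ne_zero]
          positivity
        · have hpos : 0 < x b := by
            refine lt_of_le_of_ne (not_lt.1 hneg) fun h0 => hx' ?_
            rw [(isOpen_coord_lt b 0).frontier_eq]
            refine ⟨?_, hneg⟩
            refine mem_closure_of_tendsto (b := Filter.atTop)
              (f := fun m : ℕ => x + (-(1 / ((m : ℝ) + 1))) • (EuclideanSpace.single b 1 : Space n))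
              ?_ (.of_forall fun m => ?_)
            · have := (tendsto_one_div_add_atTop_nhds_zero_nat (𝕜 := ℝ)).neg.smul_const
                (EuclideanSpace.single b 1 : Space n)
              simpa using this.const_add x
            · have : (0 : ℝ) < 1 / ((m : ℝ) + 1) := by positivity
              simp [← h0]
              positivity
          rw [if_neg hneg, lineDeriv_tent_of_pos hlam hL hxT hpos, sub_self, zero_pow two_ne_zero]
          positivity
      · simp only [displacementGradient, hb, and_false, if_true, if_false, sub_zero]
        exact sq_le_sq' (abs_le.1 (abs_lineDeriv_tent_le hlam hL hH hb x)).1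
          (abs_le.1 (abs_lineDeriv_tent_le hlam hL hH hb x)).2
    simpa using Finset.sum_le_card_nsmul _ _ _ hb
  · have hxc : x ∉ closure (bipyramid i lam L H) := fun h =>
      hx (by rw [isOpen_bipyramid.frontier_eq]; exact ⟨h, hxT⟩)
    refine le_of_eq_of_le ?_ zero_le
    simp [displacementGradient, lineDeriv_tent_eq_zero hxc, phase_apply hi, hxT]

end Energy

/-- The phase is (1-λ) times the indicator of one convex half minus λ times that of the other. Since
1-λ and λ sum to 1, each direction contributes no more than the bound for a single convex set. -/
lemma totalVariation_phase_le {m : ℕ} {i : Fin (m + 1)} {lam L H D : ℝ}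
    (hlam : lam ∈ Set.Ioo (0 : ℝ) 1) (hL : 0 < L) (hH : 0 < H) (hi : (i : ℕ) = 0) (hLD : L ≤ D)
    (hHD : H ≤ D) :
    totalVariation (phase i lam L H) ≤ ENNReal.ofReal ((m + 1) * (2 * (2 * D) ^ m)) := by
  refine iSup₂_le fun φ hφ => iSup₂_le fun hs h1 => ENNReal.ofReal_le_ofReal ?_
  set T := bipyramid i lam L H with hT
  set S : Set (Space (m + 1)) := {x | x i < 0} with hS
  have hTm : MeasurableSet T := isOpen_bipyramid.measurableSet
  have hSm : MeasurableSet S := (isOpen_coord_lt i 0).measurableSet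
  have hlin := (EuclideanSpace.proj (𝕜 := ℝ) i : Space (m + 1) →L[ℝ] ℝ).isLinear
  have hSc : Convex ℝ S := convex_halfSpace_lt hlin 0
  have hSc' : Convex ℝ Sᶜ := by
    have : Sᶜ = {x : Space (m + 1) | 0 ≤ x i} := by ext x; simp [hS]
    rw [this]
    exact convex_halfSpace_ge hlin 0
  have hD : ∀ x ∈ T, ∀ k, |x k| ≤ D := fun x hx => abs_le_of_mem_bipyramid hlam hL hH hLD hHD hx
  have hD0 : 0 ≤ D := hL.le.trans hLD
  set ψ : Fin (m + 1) → Space (m + 1) → ℝ := fun k x => φ x i i k with hψ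
  have hψc : ∀ k, ContDiff ℝ 1 (ψ k) := fun k =>
    contDiff_pi.1 (contDiff_pi.1 (contDiff_pi.1 hφ i) i) k
  have hψs : ∀ k, HasCompactSupport (ψ k) := fun k =>
    hs.comp_left (g := fun y : Fin (m + 1) → Fin (m + 1) → Fin (m + 1) → ℝ => y i i k) rfl
  have hψ1 : ∀ k x, |ψ k x| ≤ 1 := by
    intro k x
    rw [← sq_le_one_iff_abs_le_one]
    refine le_trans ?_ (h1 x)
    calc ψ k x ^ 2 ≤ ∑ k, φ x i i k ^ 2 :=
          Finset.single_le_sum (f := fun k => φ x i i k ^ 2) (fun _ _ => sq_nonneg _)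
            (Finset.mem_univ k)
      _ ≤ ∑ j, ∑ k, φ x i j k ^ 2 :=
          Finset.single_le_sum (f := fun j => ∑ k, φ x i j k ^ 2)
            (fun _ _ => Finset.sum_nonneg fun _ _ => sq_nonneg _) (Finset.mem_univ i)
      _ ≤ _ := Finset.single_le_sum (f := fun i => ∑ j, ∑ k, φ x i j k ^ 2)
            (fun _ _ => Finset.sum_nonneg fun _ _ => Finset.sum_nonneg fun _ _ => sq_nonneg _)
            (Finset.mem_univ i)
  have hd : ∀ k x, partialDeriv k φ x i i k = partialDeriv k (ψ k) x := by
    intro k x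
    have hx := (hφ.differentiable one_ne_zero).differentiableAt (x := x) |>.hasFDerivAt
    have := (hasFDerivAt_pi'.1 (hasFDerivAt_pi'.1 (hasFDerivAt_pi'.1 hx i) i) k).fderiv
    unfold partialDeriv
    rw [hψ, this]
    rfl
  have hci : ∀ k, Integrable (partialDeriv k (ψ k)) := fun k =>
    (((hψc k).continuous_fderiv one_ne_zero).clm_apply
      continuous_const).integrable_of_hasCompactSupport (hasCompactSupport_partialDeriv (hψs k) k)
  have hsplit : ∀ x, phase i lam L H x i i * ∑ k, partialDeriv k φ x i i k
      = ∑ k, ((1 - lam) * (T ∩ S).indicator (partialDeriv k (ψ k)) x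
          - lam * (T ∩ Sᶜ).indicator (partialDeriv k (ψ k)) x) := by
    intro x
    rw [phase_apply hi, if_pos ⟨rfl, rfl⟩, Finset.mul_sum]
    refine Finset.sum_congr rfl fun k _ => ?_
    rw [hd]
    by_cases hx : x ∈ T <;> by_cases hx' : x i < 0 <;> simp [Set.indicator, hx, hx', ← hT, hS]
  have hzero : ∀ a b, ¬(a = i ∧ b = i) →
      ∫ x, phase i lam L H x a b * ∑ k, partialDeriv k φ x a b k = 0 := by
    intro a b hab
    simp [phase_apply hi, hab]
  rw [Finset.sum_eq_single i (fun a _ ha => Finset.sum_eq_zero fun b _ =>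
      hzero a b fun h => ha h.1) (by simp),
    Finset.sum_eq_single i (fun b _ hb => hzero i b fun h => hb h.2) (by simp)]
  simp_rw [hsplit]
  have i1 : ∀ k, Integrable fun x => (1 - lam) * (T ∩ S).indicator (partialDeriv k (ψ k)) x :=
    fun k => ((hci k).indicator (hTm.inter hSm)).const_mul _
  have i2 : ∀ k, Integrable fun x => lam * (T ∩ Sᶜ).indicator (partialDeriv k (ψ k)) x :=
    fun k => ((hci k).indicator (hTm.inter hSm.compl)).const_mul _
  have i3 : ∀ k ∈ Finset.univ, Integrable fun x =>
      ((1 - lam) * (T ∩ S).indicator (partialDeriv k (ψ k)) x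
        - lam * (T ∩ Sᶜ).indicator (partialDeriv k (ψ k)) x) := fun k _ => (i1 k).sub (i2 k)
  rw [integral_finsetSum _ i3]
  have hk : ∀ k ∈ Finset.univ, ∫ x, ((1 - lam) * (T ∩ S).indicator (partialDeriv k (ψ k)) x
          - lam * (T ∩ Sᶜ).indicator (partialDeriv k (ψ k)) x) ≤ 2 * (2 * D) ^ m := by
    intro k _
    rw [integral_sub (i1 k) (i2 k), integral_const_mul, integral_const_mul,
      integral_indicator (hTm.inter hSm), integral_indicator (hTm.inter hSm.compl)]
    have b1 := abs_le.1 (abs_setIntegral_partialDeriv_le (convex_bipyramid.inter hSc)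
      (hTm.inter hSm) hD0 (fun x hx => hD x hx.1) k (hψc k) (hψs k) (hψ1 k))
    have b2 := abs_le.1 (abs_setIntegral_partialDeriv_le (convex_bipyramid.inter hSc')
      (hTm.inter hSm.compl) hD0 (fun x hx => hD x hx.1) k (hψc k) (hψs k) (hψ1 k))
    have c1 := mul_le_mul_of_nonneg_left b1.2 (by linarith [hlam.2] : 0 ≤ 1 - lam)
    have c2 := mul_le_mul_of_nonneg_left b2.1 hlam.1.le
    linarith
  simpa using Finset.sum_le_card_nsmul _ _ _ hk

theorem exists_minimalEnergy_le {n : ℕ} (hn : 2 ≤ n) {lam : ℝ} (hlam : lam ∈ Set.Ioo (0 : ℝ) 1) :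
    ∃ C : ℝ, ∀ V : ℝ, 0 < V → ∀ ε : ℝ, 0 < ε →
      minimalEnergy (wells n lam) ε V ≤ ENNReal.ofReal (C * scalingRate n ε V) := by
  obtain ⟨m, rfl⟩ : ∃ m, n = m + 1 := ⟨n - 1, by omega⟩
  set i : Fin (m + 1) := 0
  have hi : (i : ℕ) = 0 := rfl
  obtain ⟨hv0, hvt⟩ := volume_unit_bipyramid (i := i) hlam
  set c := (volume (bipyramid i lam 1 1)).toReal with hc
  have hc0 : 0 < c := ENNReal.toReal_pos hv0.ne' hvt.ne
  have hcv : volume (bipyramid i lam 1 1) = ENNReal.ofReal c := (ENNReal.ofReal_toReal hvt.ne).symm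
  set M := max 1 c⁻¹ with hM
  have hM1 : 1 ≤ M := le_max_left _ _
  refine ⟨((m + 1 : ℕ) : ℝ) * (c⁻¹) ^ 2 + (m + 1) * (2 * (2 * M) ^ m), fun V hV ε hε => ?_⟩
  obtain ⟨L, H, hL, hLH, hLV, hr, hrel, -⟩ := exists_scales hn hε hV
  simp only [Nat.add_sub_cancel] at hLV hr
  have hH : 0 < H := hL.trans_le hLH
  -- Dividing the width by the volume c of the unit bipyramid makes the volume exactly V; M lets one
  -- cube contain both c⁻¹ L and H.
  have hL' : 0 < c⁻¹ * L := by positivity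
  have hvol : volume (bipyramid i lam (c⁻¹ * L) H) = ENNReal.ofReal V := by
    rw [volume_bipyramid hL' hH, hcv, ← ENNReal.ofReal_mul (by positivity)]
    congr 1
    simp only [Nat.add_sub_cancel]
    rw [← hLV]
    field_simp
  have hTV := totalVariation_phase_le (D := M * H) hlam hL' hH hi
    (mul_le_mul (le_max_right _ _) hLH hL.le (by positivity)) (le_mul_of_one_le_left hH.le hM1)
  have hsupp : volume (Function.support (phase i lam (c⁻¹ * L) H)) = ENNReal.ofReal V := by
    rw [support_phase hlam hi, hvol]
  refine (iInf₂_le_of_le (phase i lam (c⁻¹ * L) H)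
    ⟨integrable_phase hlam hL' hH hi, hTV.trans_lt ENNReal.ofReal_lt_top,
      .of_forall phase_mem⟩ (iInf_le_of_le hsupp le_rfl)).trans ?_
  have hel := elasticEnergy_phase_le hlam hL' hH hi
  rw [hvol, ← ENNReal.ofReal_mul (by positivity)] at hel
  refine (add_le_add hel (mul_le_mul_right hTV (ENNReal.ofReal ε))).trans ?_
  rw [← ENNReal.ofReal_mul hε.le, ← ENNReal.ofReal_add (by positivity) (by positivity)]
  refine ENNReal.ofReal_le_ofReal ?_
  rw [add_mul (((m + 1 : ℕ) : ℝ) * c⁻¹ ^ 2)]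
  refine add_le_add ?_ ?_
  · calc ((m + 1 : ℕ) : ℝ) * (c⁻¹ * L / H) ^ 2 * V
        = ((m + 1 : ℕ) : ℝ) * c⁻¹ ^ 2 * (L ^ 2 / H ^ 2 * V) := by ring
      _ ≤ _ := by gcongr
  · refine le_of_eq ?_
    rw [hr]
    ring

end Nucleation

end

theorem corollary1p3 (n : ℕ) (hn : 2 ≤ n) (lam : ℝ) (hlam : lam ∈ Set.Ioo (0 : ℝ) 1) :
    ∃ C₁ C₂ : ℝ, 0 < C₁ ∧ C₁ < C₂ ∧ ∀ V : ℝ, 0 < V → ∀ ε : ℝ, 0 < ε →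
      ENNReal.ofReal (C₁ * Nucleation.scalingRate n ε V) ≤
          Nucleation.minimalEnergy (Nucleation.wells n lam) ε V ∧
        Nucleation.minimalEnergy (Nucleation.wells n lam) ε V ≤
          ENNReal.ofReal (C₂ * Nucleation.scalingRate n ε V) := by
  obtain ⟨C, hC⟩ := Nucleation.exists_minimalEnergy_le hn hlam
  have hmin : 0 < min lam (1 - lam) := lt_min hlam.1 (by linarith [hlam.2])
  have hn0 : (0 : ℝ) < n := by exact_mod_cast (by omega : 0 < n)
  set C₁ : ℝ := (min lam (1 - lam) ^ 2 / (64 * n)) ^ 2 with hC₁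
  -- The maximum secures the strict inequality C₁ < C₂.
  refine ⟨C₁, max C (C₁ + 1), by positivity, (lt_add_one C₁).trans_le (le_max_right _ _),
    fun V hV ε hε => ⟨Nucleation.le_minimalEnergy hn hlam rfl rfl hε hV, (hC V hV ε hε).trans ?_⟩⟩
  have := (Nucleation.scalingRate_pos (n := n) hε hV).le
  gcongr
  exact le_max_left _ _
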